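/- Let $(R,\mathfrak m,k)$ be a Noetherian local ring of dimension $d$ with infinite residue field $k$, and let $I\subseteq R$ be an ideal. Here $\lambda$ denotes length (possibly infinite). A reduction of $I$ is an ideal $J\subseteq I$ with $I^{r+1}=JI^r$ for some $r\ge 0$, and a minimal reduction is one that is minimal under inclusion. The analytic spread $\ell(I)$ is the Krull dimension of $\bigoplus_{n\ge 0}I^n/\mathfrak mI^n$. The ideal $I$ satisfies $G_d$ if for every prime $\mathfrak p\supseteq I$ with $\dim R_{\mathfrak p}=i<d$ the ideal $I_{\mathfrak p}$ can be generated by $i$ elements. A statement holds for a general minimal reduction $J$ of $I$ if, whenever $I=(a_1,\dots,a_s)$, there is a Zariski dense open set $U\subseteq k^{ds}$ such that, for all $(\alpha_{ij})\in R^{ds}$ whose image in $k^{ds}$ lies in $U$, the ideal $J=(x_1,\dots,x_d)$ with $x_i=\sum_{j}\alpha_{ij}a_j$ is a minimal reduction of $I$ for which the statement holds. (1) Assume that $\ell(I)=d$ and $I$ satisfies $G_d$, and let $n\ge 1$. Then there are integers $\delta_1,\delta_2\ge 0$ such that $\lambda(I^n/J^n)=\delta_1$ and $\lambda\big(I^n/(JI^{n-1}+I^{n+1})\big)=\delta_2$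 for a general minimal reduction $J$ of $I$; that is, these lengths are finite and do not depend on the general minimal reduction $J$. If, furthermore, $R$ is equicharacteristic, then for a general minimal reduction $J$ of $I$ and every minimal reduction $H$ of $I$, $$\lambda(I^n/J^n)\le\lambda(I^n/H^n)\quad\text{and}\quad \lambda\big(I^n/(JI^{n-1}+I^{n+1})\big)\le\lambda\big(I^n/(HI^{n-1}+I^{n+1})\big).$$ (2) Assume that $R$ is equicharacteristic and Cohen-Macaulay and that $I$ is $\mathfrak m$-primary. Then for a general minimal reduction $J$ of $I$ and every minimal reduction $H$ of $I$, $$\lambda\big((J\cap I^2)/JI\big)\le\lambda\big((H\cap I^2)/HI\big).$$ In particular, if $H\cap I^2=HI$ then $J\cap I^2=JI$. -/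

import Mathlib

open IsLocalRing

namespace GenRed

/-- `U ⊆ K^σ` is Zariski open: it is the complement of the zero locus of an ideal of polynomials. -/
def IsZariskiOpen {K σ : Type*} [Field K] (U : Set (σ → K)) : Prop :=
  ∃ 𝔞 : Ideal (MvPolynomial σ K), U = (MvPolynomial.zeroLocus K 𝔞)ᶜ

/-- `U ⊆ K^σ` is Zariski dense: it meets every nonempty Zariski open set. -/
def IsZariskiDense {K σ : Type*} [Field K] (U : Set (σ → K)) : Prop :=
  ∀ V : Set (σ → K), IsZariskiOpen V → V.Nonempty → (U ∩ V).Nonempty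

section

variable {R : Type*} [CommRing R]

/-- `J` is a reduction of `I`: `J ⊆ I` and `I ^ (r + 1) = J * I ^ r` for some `r`. -/
def IsReduction (J I : Ideal R) : Prop :=
  J ≤ I ∧ ∃ r : ℕ, I ^ (r + 1) = J * I ^ r

/-- A minimal reduction: a reduction that is minimal with respect to inclusion. -/
def IsMinimalReduction (J I : Ideal R) : Prop :=
  Minimal (fun K : Ideal R => IsReduction K I) J

/-- The length of the `R`-module `A / B`, for ideals `B ⊆ A` (possibly infinite). -/
noncomputable def quotLength (A B : Ideal R) : ℕ∞ :=
  Module.length R (A ⧸ Submodule.submoduleOf B A)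

/-- The condition `G_t`: for every prime `p ⊇ I` with `dim R_p = i < t`, the ideal `I_p` can be
generated by `i` elements. -/
def SatisfiesG (I : Ideal R) (t : ℕ) : Prop :=
  ∀ (p : Ideal R) [p.IsPrime], I ≤ p →
    ∀ i : ℕ, ringKrullDim (Localization.AtPrime p) = i → i < t →
      ∃ f : Fin i → Localization.AtPrime p,
        Ideal.span (Set.range f) = I.map (algebraMap R (Localization.AtPrime p))

variable [IsLocalRing R]

/-- The analytic spread `ℓ(I)`: the Krull dimension of the special fiber ring
`R[It] / 𝔪 R[It] = ⊕ₙ Iⁿ / 𝔪 Iⁿ`. -/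
noncomputable def analyticSpread (I : Ideal R) : WithBot ℕ∞ :=
  ringKrullDim
    (reesAlgebra I ⧸ (maximalIdeal R).map (algebraMap R (reesAlgebra I)))

variable (R) in
/-- A local ring is equicharacteristic if it has the same characteristic as its residue field
(equivalently, if it contains a field). -/
def IsEquicharacteristic : Prop :=
  ringChar R = ringChar (ResidueField R)

variable (R) in
/-- A (Noetherian) local ring is Cohen-Macaulay if its depth equals its dimension, that is, if
the maximal ideal contains a regular sequence of length `dim R`. -/
def IsCohenMacaulayLocal : Prop :=
  ∃ rs : List R, (∀ x ∈ rs, x ∈ maximalIdeal R) ∧ RingTheory.Sequence.IsRegular R rs ∧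
    ringKrullDim R = (rs.length : ℕ)

/-- The ideal `(x₁, …, x_t)` generated by the linear combinations `xᵢ = ∑ⱼ αᵢⱼ aⱼ`. -/
def combinationIdeal {t s : ℕ} (a : Fin s → R) (α : Fin t × Fin s → R) : Ideal R :=
  Ideal.span (Set.range fun i : Fin t => ∑ j : Fin s, α (i, j) * a j)

/-- The property `P` holds for a general minimal reduction of `I`: however one writes
`I = (a₁, …, a_s)`, there is a Zariski dense open subset `U` of `k ^ (t s)`, `k` the residue field,
such that for all `α ∈ R ^ (t s)` whose image in `k ^ (t s)` lies in `U`, the ideal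
`J = (x₁, …, x_t)` with `xᵢ = ∑ⱼ αᵢⱼ aⱼ` is a minimal reduction of `I` and `P J` holds.
It is used with `t = ℓ(I)`. -/
def ForGeneralMinimalReduction (I : Ideal R) (t : ℕ) (P : Ideal R → Prop) : Prop :=
  ∀ (s : ℕ) (a : Fin s → R), Ideal.span (Set.range a) = I →
    ∃ U : Set (Fin t × Fin s → ResidueField R), IsZariskiOpen U ∧ IsZariskiDense U ∧
      ∀ α : Fin t × Fin s → R, (fun ij => residue R (α ij)) ∈ U →
        IsMinimalReduction (combinationIdeal a α) I ∧ P (combinationIdeal a α)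

end

end GenRed

/-! Fix generators of `I`. The ideals generated by `d` linear combinations of them are the
specializations of one ideal of a polynomial ring `R[X]`, and the lengths in question have the form
λ(E/F(α)) with `E` an ideal of `R` and F ⊆ E·R[X]. The heart of the proof is semicontinuity
(`exists_generic_quotLength`): if δ is the length of the localization of E·R[X]/F at the prime
𝔪R[X], then δ ≤ λ(E/F(α)) for every α, with equality on a nonempty open set when δ is finite. The
lower bound passes from 𝔪R[X] to larger primes by specializing one variable at a time, with
Cayley-Hamilton in place of multiplicity theory; the upper bound spreads out a composition series by
clearing denominators.

For this to say something about all minimal reductions, each must be a specialization, and a general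
specialization must be a minimal reduction. Both follow once every analytically independent family
generating a reduction has exactly `d` members (`IndependentReductionsHaveCard`). When ℓ(I) = d this
holds because such a family of size c makes the fiber ring integral over a polynomial ring in c
variables over k. When `I` is 𝔪-primary it comes from counting monomials against the growth of
λ(R/Iⁿ), together with Krull's height theorem.

Finiteness under `G_d` comes from a basic element argument: some `d` elements of `I` generate it
modulo I² up to finite length (`SatisfiesG.exists_pow_mul_le`). By semicontinuity a general minimal
reduction `J` does so too, and since `J` is a reduction, I/J has finite length.

In the Cohen-Macaulay case J ∩ I² is not visibly a specialization. Instead λ((J ∩ I²)/JI) + λ(R/J) =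
λ(I²/JI) + λ(R/(J + I²)), where the right side is generically minimal and λ(R/J) is the same for all
minimal reductions: powers of a regular sequence have lengths given by binomial coefficients, and
comparing leading terms proves the equality. -/

namespace GenRed

/-! ### Lengths of quotients of ideals -/

section QuotLength

variable {R : Type*} [CommRing R]

theorem quotLength_add {A B C : Ideal R} (hCB : C ≤ B) (hBA : B ≤ A) :
    quotLength A C = quotLength B C + quotLength A B := by
  have h1 : Submodule.submoduleOf C B ≤
      (Submodule.submoduleOf C A).comap (Submodule.inclusion hBA) := fun x hx => hx
  have h2 : Submodule.submoduleOf C A ≤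
      (Submodule.submoduleOf B A).comap (LinearMap.id : A →ₗ[R] A) := fun x hx => hCB hx
  refine Module.length_eq_add_of_exact (Submodule.mapQ _ _ (Submodule.inclusion hBA) h1)
    (Submodule.mapQ _ _ LinearMap.id h2) ?_ ?_ ?_
  · rw [← LinearMap.ker_eq_bot, LinearMap.ker_eq_bot']
    intro x hx
    obtain ⟨x, rfl⟩ := Submodule.Quotient.mk_surjective _ x
    rw [Submodule.mapQ_apply, Submodule.Quotient.mk_eq_zero] at hx
    rw [Submodule.Quotient.mk_eq_zero]
    exact hx
  · intro y
    obtain ⟨y, rfl⟩ := Submodule.Quotient.mk_surjective _ y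
    exact ⟨Submodule.Quotient.mk y, rfl⟩
  · intro y
    obtain ⟨y, rfl⟩ := Submodule.Quotient.mk_surjective _ y
    rw [Submodule.mapQ_apply, Submodule.Quotient.mk_eq_zero]
    constructor
    · intro hy
      exact ⟨Submodule.Quotient.mk ⟨y.1, hy⟩, rfl⟩
    · rintro ⟨x, hx⟩
      obtain ⟨x, rfl⟩ := Submodule.Quotient.mk_surjective _ x
      rw [Submodule.mapQ_apply, Submodule.Quotient.eq] at hx
      have : (y : R) = x.1 - (x.1 - y.1) := by ring
      change (y : R) ∈ B
      rw [this]
      exact B.sub_mem x.2 (hCB hx)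

theorem quotLength_eq_zero_iff {A B : Ideal R} : quotLength A B = 0 ↔ A ≤ B := by
  rw [quotLength, Module.length_eq_zero_iff, Submodule.Quotient.subsingleton_iff,
    Submodule.submoduleOf, Submodule.comap_subtype_eq_top]

theorem quotLength_anti_right {A B B' : Ideal R} (h : B ≤ B') (hA : B' ≤ A) :
    quotLength A B' ≤ quotLength A B := by
  rw [quotLength_add h hA]
  exact le_add_self

theorem quotLength_sup (A B : Ideal R) : quotLength (A ⊔ B) B = quotLength A (A ⊓ B) := by
  have e := LinearMap.quotientInfEquivSupQuotient A B
  rw [quotLength, quotLength]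
  refine (LinearEquiv.length_eq e).symm.trans ?_
  congr! 2

theorem krullDim_le_quotLength {X : Type*} [Preorder X] {A B : Ideal R} (f : X → Ideal R)
    (hf : StrictMono f) (hB : ∀ x, B ≤ f x) (hA : ∀ x, f x ≤ A) :
    Order.krullDim X ≤ quotLength A B := by
  rw [quotLength, Module.coe_length]
  refine Order.krullDim_le_of_strictMono
    (fun x => (Submodule.submoduleOf (f x) A).map (Submodule.submoduleOf B A).mkQ) ?_
  intro x y hxy
  have key : ∀ z, ((Submodule.submoduleOf (f z) A).map (Submodule.submoduleOf B A).mkQ).comap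
      (Submodule.submoduleOf B A).mkQ = Submodule.submoduleOf (f z) A := by
    intro z
    rw [Submodule.comap_map_mkQ, sup_eq_right]
    exact fun w hw => hB z hw
  refine lt_of_le_of_ne (Submodule.map_mono fun w hw => (hf hxy).le hw) fun h => ?_
  have h2 := congrArg (fun N => N.comap (Submodule.submoduleOf B A).mkQ) h
  simp only [key] at h2
  refine (hf hxy).not_ge fun w hw => ?_
  have : (⟨w, hA y hw⟩ : A) ∈ Submodule.submoduleOf (f x) A := by
    rw [h2]; exact hw
  exact this

variable [IsLocalRing R]

theorem quotLength_le_one {A B : Ideal R} {y : R} (hy : y ∈ A) (hA : A ≤ B ⊔ Ideal.span {y})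
    (hm : maximalIdeal R * A ≤ B) : quotLength A B ≤ 1 := by
  have hk : maximalIdeal R ≤
      LinearMap.ker ((Submodule.submoduleOf B A).mkQ ∘ₗ LinearMap.toSpanSingleton R A ⟨y, hy⟩) := by
    intro r hr
    rw [LinearMap.mem_ker, LinearMap.comp_apply, Submodule.mkQ_apply,
      Submodule.Quotient.mk_eq_zero]
    exact hm (Ideal.mul_mem_mul hr hy)
  have hs : Function.Surjective ((maximalIdeal R).liftQ _ hk) := by
    intro z
    obtain ⟨z, rfl⟩ := Submodule.Quotient.mk_surjective _ z
    obtain ⟨b, hb, w, hw, hz⟩ := Submodule.mem_sup.1 (hA z.2)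
    obtain ⟨r, rfl⟩ := Ideal.mem_span_singleton'.1 hw
    refine ⟨Submodule.Quotient.mk r, ?_⟩
    symm
    rw [Submodule.liftQ_apply, LinearMap.comp_apply, Submodule.mkQ_apply, Submodule.Quotient.eq]
    change (z : R) - r * y ∈ B
    rw [← hz]
    simpa using hb
  have : IsSimpleModule R (R ⧸ maximalIdeal R) :=
    isSimpleModule_iff_isCoatom.2 (Ideal.isMaximal_def.1 inferInstance)
  exact (Module.length_le_of_surjective _ hs).trans (Module.length_eq_one R _).le

theorem quotLength_sup_span_ne_top {B : Ideal R} (s : Finset R)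
    (hm : maximalIdeal R * Ideal.span (s : Set R) ≤ B) :
    quotLength (B ⊔ Ideal.span (s : Set R)) B ≠ ⊤ := by
  classical
  induction s using Finset.induction_on with
  | empty => simp [quotLength_eq_zero_iff.2]
  | insert y s hy ih =>
    rw [Finset.coe_insert, Ideal.span_insert, sup_comm (Ideal.span {y})] at hm ⊢
    rw [Ideal.mul_sup, sup_le_iff] at hm
    rw [← sup_assoc, quotLength_add (B := B ⊔ Ideal.span (s : Set R)) le_sup_left le_sup_left]
    refine WithTop.add_ne_top.2 ⟨ih hm.1, ne_top_of_le_ne_top ENat.one_ne_top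
      (quotLength_le_one (y := y) ?_ le_rfl ?_)⟩
    · exact Ideal.mem_sup_right (Ideal.mem_span_singleton_self y)
    · rw [Ideal.mul_sup, Ideal.mul_sup]
      exact sup_le (sup_le (Ideal.mul_le_right.trans le_sup_left) (hm.1.trans le_sup_left))
        (hm.2.trans le_sup_left)

theorem quotLength_ne_top_of_pow [IsNoetherianRing R] {A B : Ideal R} {c : ℕ} (hBA : B ≤ A)
    (h : maximalIdeal R ^ c * A ≤ B) : quotLength A B ≠ ⊤ := by
  induction c generalizing A with
  | zero =>
    rw [pow_zero, Ideal.one_eq_top, Ideal.top_mul] at h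
    simp [quotLength_eq_zero_iff.2 h]
  | succ c ih =>
    have hle : B ⊔ maximalIdeal R * A ≤ A := sup_le hBA Ideal.mul_le_right
    rw [quotLength_add (B := B ⊔ maximalIdeal R * A) le_sup_left hle]
    refine WithTop.add_ne_top.2 ⟨ih le_sup_left ?_, ?_⟩
    · rw [Ideal.mul_sup, ← mul_assoc, ← pow_succ]
      exact sup_le Ideal.mul_le_right h
    · obtain ⟨s, hs⟩ := IsNoetherian.noetherian A
      have := quotLength_sup_span_ne_top (B := B ⊔ maximalIdeal R * A) s
        (by rw [show Ideal.span (s : Set R) = A from hs]; exact le_sup_right)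
      rwa [show Ideal.span (s : Set R) = A from hs, sup_eq_right.2 hle] at this

end QuotLength

/-! ### Saturated ideals as submodules of a localization -/

section Saturated

variable {A : Type*} [CommRing A]

/-- The ideals between `F` and `E` that are saturated in `E` with respect to the prime `P`; they
correspond to the submodules of the localization at `P` of `E / F`. -/
def saturatedIdeals (P F E : Ideal A) : Set (Ideal A) :=
  {N | F ≤ N ∧ N ≤ E ∧ ∀ s ∉ P, ∀ x ∈ E, s * x ∈ N → x ∈ N}

/-- The saturation of `N` in `E` with respect to a prime `P`. -/
def saturation (P : Ideal A) [hP : P.IsPrime] (N E : Ideal A) : Ideal A where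
  carrier := {x | x ∈ E ∧ ∃ s ∉ P, s * x ∈ N}
  zero_mem' := ⟨E.zero_mem, 1, (Ideal.ne_top_iff_one P).1 hP.ne_top, by simp⟩
  add_mem' := by
    rintro x y ⟨hx, s, hs, hsx⟩ ⟨hy, t, ht, hty⟩
    refine ⟨E.add_mem hx hy, s * t, fun h => (hP.mem_or_mem h).elim hs ht, ?_⟩
    have : s * t * (x + y) = t * (s * x) + s * (t * y) := by ring
    rw [this]
    exact N.add_mem (N.mul_mem_left _ hsx) (N.mul_mem_left _ hty)
  smul_mem' := by
    rintro c x ⟨hx, s, hs, hsx⟩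
    refine ⟨E.mul_mem_left _ hx, s, hs, ?_⟩
    have : s * (c • x) = c * (s * x) := by rw [smul_eq_mul]; ring
    rw [this]
    exact N.mul_mem_left _ hsx

variable {P F E N : Ideal A} [hP : P.IsPrime]

theorem le_saturation (h : N ≤ E) : N ≤ saturation P N E := fun x hx =>
  ⟨h hx, 1, (Ideal.ne_top_iff_one P).1 hP.ne_top, by simpa using hx⟩

theorem saturation_mono {N' : Ideal A} (h : N ≤ N') : saturation P N E ≤ saturation P N' E :=
  fun _ ⟨hx, s, hs, hsx⟩ => ⟨hx, s, hs, h hsx⟩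

theorem saturation_mem_saturatedIdeals (hF : F ≤ N) (h : N ≤ E) :
    saturation P N E ∈ saturatedIdeals P F E := by
  refine ⟨hF.trans (le_saturation h), fun x hx => hx.1, ?_⟩
  rintro s hs x hx ⟨-, t, ht, htx⟩
  exact ⟨hx, t * s, fun h => (hP.mem_or_mem h).elim ht hs, by rwa [mul_assoc]⟩

theorem saturation_le_of_mem {N' : Ideal A} (h : N ≤ N') (hN' : N' ∈ saturatedIdeals P F E) :
    saturation P N E ≤ N' := by
  rintro x ⟨hx, s, hs, hsx⟩
  exact hN'.2.2 s hs x hx (h hsx)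

theorem exists_notMem_mul_le_of_le_saturation {K : Ideal A} (hK : K.FG)
    (h : K ≤ saturation P N E) : ∃ s ∉ P, Ideal.span {s} * K ≤ N := by
  classical
  obtain ⟨T, rfl⟩ := hK
  induction T using Finset.induction_on with
  | empty => exact ⟨1, (Ideal.ne_top_iff_one P).1 hP.ne_top, by simp⟩
  | insert y T hy ih =>
    simp only [Finset.coe_insert] at h ⊢
    rw [Ideal.span_insert, sup_le_iff] at h
    obtain ⟨s, hs, hs'⟩ := ih h.2
    obtain ⟨-, t, ht, ht'⟩ := h.1 (Submodule.mem_span_singleton_self y)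
    refine ⟨s * t, fun h => (hP.mem_or_mem h).elim hs ht, ?_⟩
    rw [Ideal.span_insert, Ideal.mul_sup, sup_le_iff]
    constructor
    · rw [Ideal.span_singleton_mul_span_singleton,
        Ideal.span_singleton_le_iff_mem, mul_assoc]
      exact N.mul_mem_left _ ht'
    · rw [← Ideal.span_singleton_mul_span_singleton, mul_comm (Ideal.span {s}), mul_assoc]
      exact (Ideal.mul_mono_right hs').trans Ideal.mul_le_right

/-- Cayley-Hamilton for multiplication by `s` on `K / N`. -/
theorem exists_pow_add_mul_le {K N 𝔟 : Ideal A} {s : A} (hK : K.FG)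
    (h : Ideal.span {s} * K ≤ N ⊔ 𝔟 * K) :
    ∃ r : ℕ, ∃ b ∈ 𝔟, Ideal.span {s ^ r + b} * K ≤ N := by
  have : Module.Finite A K := Module.Finite.iff_fg.2 hK
  let Q := K ⧸ Submodule.submoduleOf N K
  let f : Module.End A Q := s • LinearMap.id
  have hf : LinearMap.range f ≤ 𝔟 • (⊤ : Submodule A Q) := by
    rintro _ ⟨z, rfl⟩
    obtain ⟨z, rfl⟩ := Submodule.Quotient.mk_surjective _ z
    obtain ⟨n, hn, w, hw, hz⟩ := Submodule.mem_sup.1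
      (h (Ideal.mul_mem_mul (Ideal.mem_span_singleton_self s) z.2))
    have hwK : w ∈ K := Ideal.mul_le_right hw
    have h1 : (⟨w, hwK⟩ : K) ∈ 𝔟 • (⊤ : Submodule A K) := by
      have h2 : Submodule.map K.subtype (𝔟 • (⊤ : Submodule A K)) = 𝔟 * K := by
        rw [Submodule.map_smul'', Submodule.map_top, Submodule.range_subtype, smul_eq_mul]
      rw [← h2] at hw
      obtain ⟨v, hv, hvw⟩ := hw
      have : v = ⟨w, hwK⟩ := Subtype.ext hvw
      rwa [← this]
    have h3 : f (Submodule.Quotient.mk z) = (Submodule.submoduleOf N K).mkQ ⟨w, hwK⟩ := by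
      change s • (Submodule.submoduleOf N K).mkQ z = _
      rw [← map_smul, Submodule.mkQ_apply, Submodule.mkQ_apply, Submodule.Quotient.eq]
      change s * (z : A) - w ∈ N
      rw [← hz]; simpa using hn
    rw [h3]
    have h4 := Submodule.mem_map_of_mem (f := (Submodule.submoduleOf N K).mkQ) h1
    rw [Submodule.map_smul''] at h4
    exact Submodule.smul_mono le_rfl le_top h4
  obtain ⟨p, hp, -, hcoeff, hz⟩ :=
    LinearMap.exists_monic_and_natDegree_eq_and_coeff_mem_pow_and_aeval_eq_zero A f 𝔟 hf
  refine ⟨p.natDegree, p.eval s - s ^ p.natDegree, ?_, ?_⟩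
  · rw [Polynomial.eval_eq_sum_range, Finset.sum_range_succ, hp.coeff_natDegree, one_mul,
      add_sub_cancel_right]
    refine Ideal.sum_mem _ fun i hi => Ideal.mul_mem_right _ _ ?_
    refine Ideal.pow_le_self ?_ (hcoeff i)
    have := Finset.mem_range.1 hi
    omega
  · rw [add_sub_cancel]
    refine Ideal.mul_le.2 ?_
    intro a ha x hx
    obtain ⟨c, rfl⟩ := Ideal.mem_span_singleton'.1 ha
    have h5 : Polynomial.aeval f p = p.eval s • (LinearMap.id : Q →ₗ[A] Q) := by
      have : f = algebraMap A (Module.End A Q) s := rfl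
      rw [this, Polynomial.aeval_algebraMap_apply]
      rfl
    have h6 := LinearMap.congr_fun (h5.symm.trans hz) (Submodule.Quotient.mk ⟨x, hx⟩)
    have h7 : (Submodule.submoduleOf N K).mkQ (p.eval s • ⟨x, hx⟩) = 0 := by
      rw [map_smul]; exact h6
    rw [Submodule.mkQ_apply, Submodule.Quotient.mk_eq_zero] at h7
    rw [mul_assoc]
    exact N.mul_mem_left _ h7

end Saturated
end GenRed

namespace GenRed

section Saturated

variable {A : Type*} [CommRing A] [IsNoetherianRing A]

/-- In terms of M = E/F: the length of M_P is at most that of (M/tM)_{P'}. Sending `N` to the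
saturation of N + tE is strictly monotone: if `N < N'` had the same image, some s ∉ P' would carry
`N'` into N + tN', and Cayley-Hamilton would yield an element outside `P` carrying `N'` into `N`. -/
theorem krullDim_saturatedIdeals_le {P P' F E : Ideal A} [P.IsPrime] [hP' : P'.IsPrime]
    {t : A} (ht : t ∉ P) (hPP' : P ≤ P') (ht' : t ∈ P') :
    Order.krullDim (saturatedIdeals P F E) ≤
      Order.krullDim (saturatedIdeals P' (F ⊔ Ideal.span {t} * E) E) := by
  have hle : ∀ N ∈ saturatedIdeals P F E, N ⊔ Ideal.span {t} * E ≤ E := fun N hN =>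
    sup_le hN.2.1 Ideal.mul_le_right
  refine Order.krullDim_le_of_strictMono
    (fun N => ⟨saturation P' (N.1 ⊔ Ideal.span {t} * E) E,
      saturation_mem_saturatedIdeals (sup_le_sup_right N.2.1 _) (hle _ N.2)⟩) ?_
  intro N N' hNN'
  have hNN : N.1 < N'.1 := hNN'
  refine lt_of_le_of_ne (saturation_mono (sup_le_sup_right hNN.le _)) fun heq => ?_
  have heq' : saturation P' (N.1 ⊔ Ideal.span {t} * E) E =
      saturation P' (N'.1 ⊔ Ideal.span {t} * E) E := congrArg Subtype.val heq
  obtain ⟨s, hs, hsN⟩ := exists_notMem_mul_le_of_le_saturation (P := P') (E := E)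
    (N := N.1 ⊔ Ideal.span {t} * E) (K := N'.1) (IsNoetherian.noetherian _)
    (by rw [heq']; exact le_sup_left.trans (le_saturation (hle _ N'.2)))
  -- Since `N'` is saturated at `P` and `t ∉ P`, an element `t * e` of `N'` has `e ∈ N'`; this turns
  -- tE into tN'.
  have hsN' : Ideal.span {s} * N'.1 ≤ N.1 ⊔ Ideal.span {t} * N'.1 := by
    intro z hz
    obtain ⟨n, hn, w, hw, rfl⟩ := Submodule.mem_sup.1 (hsN hz)
    obtain ⟨e, he, rfl⟩ := Ideal.mem_span_singleton_mul.1 hw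
    have h1 : t * e ∈ N'.1 := by
      have := N'.1.sub_mem (Ideal.mul_le_right hz) (hNN.le hn)
      simpa using this
    exact Submodule.add_mem_sup hn
      (Ideal.mul_mem_mul (Ideal.mem_span_singleton_self t) (N'.2.2.2 t ht e he h1))
  obtain ⟨r, b, hb, hrb⟩ := exists_pow_add_mul_le (IsNoetherian.noetherian _) hsN'
  refine hNN.not_ge fun x hx => ?_
  refine N.2.2.2 (s ^ r + b) (fun h => hs ?_) x (N'.2.2.1 hx)
    (hrb (Ideal.mul_mem_mul (Ideal.mem_span_singleton_self _) hx))
  have hb' : b ∈ P' := by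
    obtain ⟨c, rfl⟩ := Ideal.mem_span_singleton'.1 hb
    exact P'.mul_mem_left _ ht'
  have := P'.sub_mem (hPP' h) hb'
  rw [add_sub_cancel_right] at this
  exact hP'.mem_of_pow_mem r this

end Saturated

/-! ### Semicontinuity of length under specialization of variables -/

section Specialization

variable {R : Type*} [CommRing R] {σ : Type*}

open MvPolynomial

theorem sub_C_eval_mem_span (α : σ → R) (f : MvPolynomial σ R) (S : Set σ) (hS : S = Set.univ) :
    f - C (eval α f) ∈ Ideal.span ((fun j => X j - C (α j)) '' S) := by
  subst hS
  induction f using MvPolynomial.induction_on with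
  | C a => simp
  | add p q hp hq =>
    have : p + q - C (eval α (p + q)) = (p - C (eval α p)) + (q - C (eval α q)) := by
      simp only [map_add]; ring
    rw [this]
    exact Ideal.add_mem _ hp hq
  | mul_X p j hp =>
    have : p * X j - C (eval α (p * X j)) =
        X j * (p - C (eval α p)) + C (eval α p) * (X j - C (α j)) := by
      simp only [map_mul, eval_X]; ring
    rw [this]
    exact Ideal.add_mem _ (Ideal.mul_mem_left _ _ hp)
      (Ideal.mul_mem_left _ _ (Ideal.subset_span ⟨j, trivial, rfl⟩))

/-- Membership in the product of (X − α) and E·R[X], not merely in their intersection, is what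
identifies E·R[X]/(F + (X − α)E·R[X]) with E/F(α). -/
theorem sub_C_eval_mem_span_mul (α : σ → R) (E : Ideal R) {f : MvPolynomial σ R}
    (hf : f ∈ E.map (C : R →+* MvPolynomial σ R)) :
    f - C (eval α f) ∈
      Ideal.span ((fun j => X j - C (α j)) '' Set.univ) * E.map (C : R →+* MvPolynomial σ R) := by
  refine Submodule.span_induction ?_ ?_ ?_ ?_ hf
  · rintro _ ⟨e, -, rfl⟩
    simp
  · simp
  · intro p q _ _ hp hq
    have : p + q - C (eval α (p + q)) = (p - C (eval α p)) + (q - C (eval α q)) := by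
      simp only [map_add]; ring
    rw [this]
    exact Ideal.add_mem _ hp hq
  · intro g p hp' hp
    have : g • p - C (eval α (g • p)) =
        C (eval α g) * (p - C (eval α p)) + (g - C (eval α g)) * p := by
      simp only [smul_eq_mul, map_mul]; ring
    rw [this]
    exact Ideal.add_mem _ (Ideal.mul_mem_left _ _ hp)
      (Ideal.mul_mem_mul (sub_C_eval_mem_span α g _ rfl) hp')

theorem map_eval_map_C (α : σ → R) (E : Ideal R) :
    (E.map (C : R →+* MvPolynomial σ R)).map (eval α) = E := by
  rw [Ideal.map_map]
  have : (eval α).comp (C : R →+* MvPolynomial σ R) = RingHom.id R := by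
    ext r; simp
  rw [this, Ideal.map_id]

variable [IsLocalRing R]

open Classical in
/-- Reduction modulo the maximal ideal, with the variables in `S` specialized to `α`. -/
noncomputable def partialEval (α : σ → R) (S : Set σ) :
    MvPolynomial σ R →+* MvPolynomial σ (ResidueField R) :=
  eval₂Hom (C.comp (residue R)) fun j => if j ∈ S then C (residue R (α j)) else X j

/-- The prime ideal of the polynomials over `R` that vanish under `partialEval`. -/
noncomputable def partialPrime (α : σ → R) (S : Set σ) :
    Ideal (MvPolynomial σ R) :=
  RingHom.ker (partialEval α S)

instance (α : σ → R) (S : Set σ) : (partialPrime α S).IsPrime :=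
  RingHom.ker_isPrime _

variable (R σ) in
/-- The extension of the maximal ideal of `R` to a polynomial ring over `R`. -/
noncomputable def genericPrime : Ideal (MvPolynomial σ R) :=
  RingHom.ker (MvPolynomial.map (residue R) : MvPolynomial σ R →+* _)

instance : (genericPrime R σ).IsPrime :=
  RingHom.ker_isPrime _

theorem partialPrime_empty (α : σ → R) : partialPrime α ∅ = genericPrime R σ := by
  have : partialEval α ∅ = MvPolynomial.map (residue R) := by
    refine MvPolynomial.ringHom_ext ?_ ?_ <;> intro j <;> simp [partialEval]
  rw [partialPrime, genericPrime, this]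

theorem mem_genericPrime {f : MvPolynomial σ R} :
    f ∈ genericPrime R σ ↔ MvPolynomial.map (residue R) f = 0 := by
  rw [genericPrime, RingHom.mem_ker]

theorem X_sub_C_notMem_partialPrime (α : σ → R) (S : Set σ) {j : σ}
    (hj : j ∉ S) : X j - C (α j) ∉ partialPrime α S := by
  rw [partialPrime, RingHom.mem_ker, map_sub]
  simp only [partialEval, coe_eval₂Hom, eval₂_X, eval₂_C, if_neg hj, RingHom.comp_apply]
  intro h
  have h1 := congrArg (coeff (Finsupp.single j 1)) h
  classical
  rw [coeff_sub, coeff_C, if_neg (fun h => by simpa using (DFunLike.congr_fun h j)),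
    coeff_zero, sub_zero, coeff_X, if_pos rfl] at h1
  exact one_ne_zero h1

theorem X_sub_C_mem_partialPrime (α : σ → R) (S : Set σ) {j : σ}
    (hj : j ∈ S) : X j - C (α j) ∈ partialPrime α S := by
  rw [partialPrime, RingHom.mem_ker, map_sub]
  simp only [partialEval, coe_eval₂Hom, eval₂_X, eval₂_C, if_pos hj, RingHom.comp_apply]
  exact sub_self _

open Classical in
theorem partialPrime_mono (α : σ → R) {S T : Set σ} (h : S ⊆ T) :
    partialPrime α S ≤ partialPrime α T := by
  intro f hf
  rw [partialPrime, RingHom.mem_ker] at hf ⊢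
  have : partialEval α T = (eval₂Hom C fun j => if j ∈ T then C (residue R (α j)) else X j :
      MvPolynomial σ (ResidueField R) →+* MvPolynomial σ (ResidueField R)).comp
      (partialEval α S) := by
    refine MvPolynomial.ringHom_ext ?_ ?_
    · intro r; simp [partialEval]
    · intro j
      by_cases hS : j ∈ S
      · simp [partialEval, hS, h hS]
      · simp [partialEval, hS]
  rw [this, RingHom.comp_apply, hf, map_zero]

/-- The variables are specialized one at a time: each step enlarges the prime and kills one `X j - C
(α j)`, so `krullDim_saturatedIdeals_le` applies. Once all are killed, evaluation at `α` embeds the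
remaining lattice into the ideals between F(α) and `E`. -/
theorem krullDim_saturatedIdeals_le_quotLength [Finite σ] [IsNoetherianRing R]
    (E : Ideal R) (F : Ideal (MvPolynomial σ R)) (α : σ → R) :
    Order.krullDim (saturatedIdeals (genericPrime R σ) F (E.map C)) ≤
      quotLength E (F.map (eval α)) := by
  classical
  have : Fintype σ := Fintype.ofFinite σ
  have key : ∀ S : Finset σ, Order.krullDim (saturatedIdeals (genericPrime R σ) F (E.map C)) ≤
      Order.krullDim (saturatedIdeals (partialPrime α (S : Set σ))
        (F ⊔ Ideal.span ((fun j => X j - C (α j)) '' (S : Set σ)) * E.map C) (E.map C)) := by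
    intro S
    induction S using Finset.induction_on with
    | empty =>
      rw [Finset.coe_empty, partialPrime_empty, Set.image_empty, Ideal.span_empty, Ideal.bot_mul,
        sup_bot_eq]
    | insert j S hj ih =>
      refine ih.trans ((krullDim_saturatedIdeals_le (P' := partialPrime α ((insert j S : Finset σ) : Set σ))
        (t := X j - C (α j)) (X_sub_C_notMem_partialPrime α _ (by simpa using hj))
        (partialPrime_mono α (by simp [Set.subset_insert])) (X_sub_C_mem_partialPrime α _ (by simp))).trans_eq ?_)
      have himage : (fun j => X j - C (α j)) '' ((insert j S : Finset σ) : Set σ) =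
          (fun j => X j - C (α j)) '' (S : Set σ) ∪ {X j - C (α j)} := by
        rw [Finset.coe_insert, Set.image_insert_eq, Set.union_comm, Set.singleton_union]
      rw [sup_assoc, ← Ideal.sup_mul, ← Ideal.span_union, himage]
  refine (key Finset.univ).trans ?_
  refine krullDim_le_quotLength (fun N => N.1.map (eval α)) ?_ ?_ ?_
  · intro N N' h
    have hlt : N.1 < N'.1 := h
    refine lt_of_le_of_ne (Ideal.map_mono hlt.le) fun heq => hlt.not_ge fun x hx => ?_
    have hx' : eval α x ∈ N.1.map (eval α) := by
      have heq' : N.1.map (eval α) = N'.1.map (eval α) := heq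
      rw [heq']
      exact Ideal.mem_map_of_mem _ hx
    obtain ⟨y, hy, hxy⟩ := (Ideal.mem_map_iff_of_surjective (eval α)
      (fun r => ⟨C r, eval_C r⟩)).1 hx'
    have h1 := sub_C_eval_mem_span_mul α E (Ideal.sub_mem _ (N'.2.2.1 hx) (N.2.2.1 hy))
    rw [map_sub, hxy, sub_self, map_zero, sub_zero] at h1
    have h2 := N.1.add_mem (N.2.1 (Ideal.mem_sup_right (by simpa using h1))) hy
    simpa using h2
  · intro N
    exact Ideal.map_mono (le_sup_left.trans N.2.1)
  · intro N
    exact (Ideal.map_mono N.2.2.1).trans (map_eval_map_C α E).le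

/-- A composition series over the local ring at 𝔪R[X] spreads out: each simple factor is cyclic and
killed by the prime after inverting one polynomial outside 𝔪R[X]. Where the product of these
polynomials takes a unit value, every specialized factor is cyclic over k, hence of length at most
one. -/
theorem exists_quotLength_le_height [IsNoetherianRing R] [Finite σ]
    (E : Ideal R) (F : Ideal (MvPolynomial σ R)) (n : ℕ)
    (N : saturatedIdeals (genericPrime R σ) F (E.map C)) (hN : Order.height N ≤ n) :
    ∃ f ∉ genericPrime R σ, ∀ α : σ → R, IsUnit (eval α f) →
      quotLength (N.1.map (eval α)) (F.map (eval α)) ≤ n := by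
  have hsurj : ∀ α : σ → R, Function.Surjective (eval α) := fun α r => ⟨C r, eval_C r⟩
  have hunit : ∀ (α : σ → R) (f : MvPolynomial σ R) (K L : Ideal (MvPolynomial σ R)),
      IsUnit (eval α f) → Ideal.span {f} * K ≤ L → K.map (eval α) ≤ L.map (eval α) := by
    intro α f K L hf h
    have h1 := Ideal.map_mono (f := eval α) h
    rwa [Ideal.map_mul, Ideal.map_span, Set.image_singleton, Ideal.span_singleton_eq_top.2 hf,
      Ideal.top_mul] at h1
  induction n generalizing N with
  | zero =>
    have hmin : IsMin N := Order.height_eq_zero.1 (nonpos_iff_eq_zero.1 (by simpa using hN))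
    have hFE : F ≤ E.map C := N.2.1.trans N.2.2.1
    let N₀ : saturatedIdeals (genericPrime R σ) F (E.map C) :=
      ⟨saturation (genericPrime R σ) F (E.map C), saturation_mem_saturatedIdeals le_rfl hFE⟩
    have hle : N₀ ≤ N := saturation_le_of_mem (P := genericPrime R σ) N.2.1 N.2
    obtain ⟨f, hf, hfN⟩ := exists_notMem_mul_le_of_le_saturation
      (IsNoetherian.noetherian _) (show N.1 ≤ saturation (genericPrime R σ) F (E.map C) from hmin hle)
    refine ⟨f, hf, fun α hα => ?_⟩
    rw [quotLength_eq_zero_iff.2 (hunit α f _ _ hα hfN)]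
    exact bot_le
  | succ n ih =>
    by_cases hmin : IsMin N
    · obtain ⟨f, hf, h⟩ := ih N (by rw [Order.height_eq_zero.2 hmin]; exact bot_le)
      exact ⟨f, hf, fun α hα => (h α hα).trans (by exact_mod_cast Nat.le_succ n)⟩
    obtain ⟨K, hKN⟩ := not_isMin_iff.1 hmin
    obtain ⟨L, -, hLN⟩ := exists_le_covBy_of_lt hKN
    have hlt : L.1 < N.1 := hLN.1
    obtain ⟨y, hyN, hyL⟩ := SetLike.exists_of_lt hlt
    have hy : L.1 ⊔ Ideal.span {y} ≤ N.1 :=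
      sup_le hlt.le ((Ideal.span_singleton_le_iff_mem _).2 hyN)
    have hPN : L.1 ⊔ genericPrime R σ * N.1 ≤ N.1 := sup_le hlt.le Ideal.mul_le_right
    -- The cover `L ⋖ N` is a simple module after localization. Comparison with `L₁` shows that `y`
    -- generates it; comparison with `L₂`, by Nakayama in the form of Cayley-Hamilton, that the
    -- prime kills it.
    let L₁ : saturatedIdeals (genericPrime R σ) F (E.map C) :=
      ⟨saturation (genericPrime R σ) (L.1 ⊔ Ideal.span {y}) (E.map C),
        saturation_mem_saturatedIdeals (L.2.1.trans le_sup_left) (hy.trans N.2.2.1)⟩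
    let L₂ : saturatedIdeals (genericPrime R σ) F (E.map C) :=
      ⟨saturation (genericPrime R σ) (L.1 ⊔ genericPrime R σ * N.1) (E.map C),
        saturation_mem_saturatedIdeals (L.2.1.trans le_sup_left) (hPN.trans N.2.2.1)⟩
    have hL₁ : L₁ = N := by
      refine (hLN.eq_or_eq (c := L₁) (le_sup_left.trans (le_saturation (hy.trans N.2.2.1)))
        (saturation_le_of_mem (P := genericPrime R σ) hy N.2)).resolve_left fun h => hyL ?_
      rw [← h]
      exact le_saturation (hy.trans N.2.2.1)
        (Ideal.mem_sup_right (Ideal.mem_span_singleton_self y))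
    have hL₂ : L₂ = L := by
      refine (hLN.eq_or_eq (c := L₂) (le_sup_left.trans (le_saturation (hPN.trans N.2.2.1)))
        (saturation_le_of_mem (P := genericPrime R σ) hPN N.2)).resolve_right fun h => ?_
      obtain ⟨s, hs, hsN⟩ := exists_notMem_mul_le_of_le_saturation (P := genericPrime R σ)
        (IsNoetherian.noetherian N.1) (le_of_eq (congrArg Subtype.val h).symm)
      obtain ⟨r, b, hb, hrb⟩ := exists_pow_add_mul_le (IsNoetherian.noetherian _) hsN
      refine hlt.not_ge fun x hx => L.2.2.2 (s ^ r + b) (fun h => hs ?_) x (N.2.2.1 hx)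
        (hrb (Ideal.mul_mem_mul (Ideal.mem_span_singleton_self _) hx))
      have := (genericPrime R σ).sub_mem h hb
      rw [add_sub_cancel_right] at this
      exact Ideal.IsPrime.mem_of_pow_mem inferInstance r this
    have hmN : genericPrime R σ * N.1 ≤ L.1 := by
      conv_rhs => rw [← hL₂]
      exact le_sup_right.trans (le_saturation (hPN.trans N.2.2.1))
    obtain ⟨u, hu, huN⟩ := exists_notMem_mul_le_of_le_saturation (P := genericPrime R σ)
      (IsNoetherian.noetherian N.1) (le_of_eq (congrArg Subtype.val hL₁).symm)
    obtain ⟨f, hf, hfL⟩ := ih L (by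
      have h1 := (Order.height_add_one_le hLN.1).trans hN
      push_cast at h1
      exact (ENat.add_le_add_iff_right ENat.one_ne_top).1 h1)
    refine ⟨f * u, fun h => (Ideal.IsPrime.mem_or_mem inferInstance h).elim hf hu, fun α hα => ?_⟩
    rw [map_mul, IsUnit.mul_iff] at hα
    rw [quotLength_add (Ideal.map_mono L.2.1) (Ideal.map_mono hlt.le), Nat.cast_succ]
    refine add_le_add (hfL α hα.1) (quotLength_le_one (y := eval α y)
      (Ideal.mem_map_of_mem _ hyN) ?_ ?_)
    · refine (hunit α u _ _ hα.2 huN).trans ?_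
      rw [Ideal.map_sup, Ideal.map_span, Set.image_singleton]
    · have hC : (maximalIdeal R).map C ≤ genericPrime R σ := by
        rw [Ideal.map_le_iff_le_comap]
        intro r hr
        rw [Ideal.mem_comap, mem_genericPrime, MvPolynomial.map_C,
          (residue_eq_zero_iff r).2 hr, map_zero]
      calc maximalIdeal R * N.1.map (eval α)
          = ((maximalIdeal R).map C * N.1).map (eval α) := by
            rw [Ideal.map_mul, map_eval_map_C]
        _ ≤ L.1.map (eval α) := Ideal.map_mono ((Ideal.mul_mono_left hC).trans hmN)

/-- The length of `E / F(α)` attains its minimum `δ` on a nonempty open set of parameters. -/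
theorem exists_generic_quotLength [IsNoetherianRing R] [Finite σ]
    (E : Ideal R) (F : Ideal (MvPolynomial σ R)) (hF : F ≤ E.map C) :
    ∃ δ : ℕ∞, (∀ α : σ → R, δ ≤ quotLength E (F.map (eval α))) ∧
      (δ ≠ ⊤ → ∃ f : MvPolynomial σ R, MvPolynomial.map (residue R) f ≠ 0 ∧
        ∀ α : σ → R, IsUnit (eval α f) → quotLength E (F.map (eval α)) ≤ δ) := by
  let N : saturatedIdeals (genericPrime R σ) F (E.map C) := ⟨E.map C, hF, le_rfl, fun _ _ _ h _ => h⟩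
  refine ⟨Order.height N, fun α => ?_, fun h => ?_⟩
  · exact WithBot.coe_le_coe.1 ((Order.height_le_krullDim N).trans
      (krullDim_saturatedIdeals_le_quotLength E F α))
  · lift Order.height N to ℕ using h with n hn
    obtain ⟨f, hf, hfN⟩ := exists_quotLength_le_height E F n N hn.ge
    refine ⟨f, fun h => hf (mem_genericPrime.2 h), fun α hα => ?_⟩
    have := hfN α hα
    rwa [map_eval_map_C] at this

end Specialization

end GenRed

namespace GenRed
open MvPolynomial

/-! ### Generic properties and Zariski open dense sets -/

section Generic

variable {R : Type*} [CommRing R] [IsLocalRing R] {σ : Type*}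

/-- `Q α` holds for all `α` at which some polynomial, nonzero modulo the maximal ideal, takes a
unit value. -/
def Generically (Q : (σ → R) → Prop) : Prop :=
  ∃ f : MvPolynomial σ R, MvPolynomial.map (residue R) f ≠ 0 ∧ ∀ α, IsUnit (eval α f) → Q α

theorem isUnit_eval_iff (α : σ → R) (f : MvPolynomial σ R) :
    IsUnit (eval α f) ↔ eval (fun j => residue R (α j)) (MvPolynomial.map (residue R) f) ≠ 0 := by
  have : eval (fun j => residue R (α j)) (MvPolynomial.map (residue R) f) =
      residue R (eval α f) := by
    rw [eval_map, ← MvPolynomial.eval₂_id (p := f) , MvPolynomial.hom_eval₂]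
    rfl
  rw [this, residue_ne_zero_iff_isUnit]

theorem Generically.mono {Q Q' : (σ → R) → Prop} (h : Generically Q) (hQ : ∀ α, Q α → Q' α) :
    Generically Q' := by
  obtain ⟨f, hf, h⟩ := h
  exact ⟨f, hf, fun α hα => hQ α (h α hα)⟩

theorem Generically.and {Q Q' : (σ → R) → Prop} (h : Generically Q) (h' : Generically Q') :
    Generically fun α => Q α ∧ Q' α := by
  obtain ⟨f, hf, h⟩ := h
  obtain ⟨g, hg, h'⟩ := h'
  refine ⟨f * g, by rw [map_mul]; exact mul_ne_zero hf hg, fun α hα => ?_⟩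
  rw [map_mul, IsUnit.mul_iff] at hα
  exact ⟨h α hα.1, h' α hα.2⟩

theorem generically_of_forall {Q : (σ → R) → Prop} (h : ∀ α, Q α) : Generically Q :=
  ⟨1, by rw [map_one]; exact one_ne_zero, fun α _ => h α⟩

theorem Generically.exists [Infinite (ResidueField R)] {Q : (σ → R) → Prop}
    (h : Generically Q) : ∃ α, Q α := by
  obtain ⟨f, hf, h⟩ := h
  obtain ⟨v, hv⟩ : ∃ v, eval v (MvPolynomial.map (residue R) f) ≠ 0 := by
    by_contra! hcon
    exact hf (MvPolynomial.funext fun v => by rw [hcon v, map_zero])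
  choose α hα using fun j => residue_surjective (v j)
  refine ⟨α, h α ((isUnit_eval_iff α f).2 ?_)⟩
  simpa [hα] using hv

theorem isZariskiOpen_ne_zero {K : Type*} [Field K] (g : MvPolynomial σ K) :
    IsZariskiOpen {v : σ → K | eval v g ≠ 0} := by
  refine ⟨Ideal.span {g}, ?_⟩
  ext v
  rw [Set.mem_ofPred_eq, Set.mem_compl_iff, MvPolynomial.mem_zeroLocus_iff, not_iff_not]
  constructor
  · intro h p hp
    obtain ⟨q, rfl⟩ := Ideal.mem_span_singleton'.1 hp
    rw [map_mul, MvPolynomial.aeval_eq_eval]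
    exact mul_eq_zero_of_right _ h
  · intro h
    have := h g (Ideal.mem_span_singleton_self g)
    simpa [MvPolynomial.aeval_eq_eval] using this

theorem isZariskiDense_ne_zero {K : Type*} [Field K] [Infinite K] {g : MvPolynomial σ K}
    (hg : g ≠ 0) : IsZariskiDense {v : σ → K | eval v g ≠ 0} := by
  rintro V ⟨𝔞, rfl⟩ ⟨w, hw⟩
  rw [Set.mem_compl_iff, MvPolynomial.mem_zeroLocus_iff] at hw
  push Not at hw
  obtain ⟨p, hp, hpw⟩ := hw
  have hp0 : p ≠ 0 := by rintro rfl; simp at hpw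
  obtain ⟨v, hv⟩ : ∃ v, eval v (g * p) ≠ 0 := by
    by_contra! hcon
    exact mul_ne_zero hg hp0 (MvPolynomial.funext fun v => by rw [hcon v, map_zero])
  rw [map_mul, mul_ne_zero_iff] at hv
  refine ⟨v, hv.1, ?_⟩
  rw [Set.mem_compl_iff, MvPolynomial.mem_zeroLocus_iff]
  intro h
  exact hv.2 (by simpa [MvPolynomial.aeval_eq_eval] using h p hp)

theorem forGeneralMinimalReduction_of_generically [Infinite (ResidueField R)] {I : Ideal R} {t : ℕ}
    {P : Ideal R → Prop}
    (h : ∀ (s : ℕ) (a : Fin s → R), Ideal.span (Set.range a) = I →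
      Generically fun α : Fin t × Fin s → R =>
        IsMinimalReduction (combinationIdeal a α) I ∧ P (combinationIdeal a α)) :
    ForGeneralMinimalReduction I t P := by
  intro s a ha
  obtain ⟨f, hf, h⟩ := h s a ha
  exact ⟨_, isZariskiOpen_ne_zero (MvPolynomial.map (residue R) f), isZariskiDense_ne_zero hf,
    fun α hα => h α ((isUnit_eval_iff α f).2 hα)⟩

/-- Lengths of families of quotients are generically minimal. -/
theorem generically_quotLength_le [IsNoetherianRing R] [Finite σ]
    {E : Ideal R} {F : Ideal (MvPolynomial σ R)} (hF : F ≤ E.map C) :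
    Generically fun α : σ → R =>
      ∀ β : σ → R, quotLength E (F.map (eval α)) ≤ quotLength E (F.map (eval β)) := by
  obtain ⟨δ, h1, h2⟩ := exists_generic_quotLength E F hF
  by_cases hδ : δ = ⊤
  · refine generically_of_forall fun α β => ?_
    have : quotLength E (F.map (eval β)) = ⊤ := top_le_iff.1 (hδ ▸ h1 β)
    rw [this]
    exact le_top
  · exact (show Generically _ from h2 hδ).mono fun α hα β => hα.trans (h1 β)

end Generic

/-! ### Reductions and analytic independence -/

section Reduction

variable {R : Type*} [CommRing R]

theorem IsReduction.pow_le {I J : Ideal R} {r : ℕ} (h : I ^ (r + 1) = J * I ^ r) (k : ℕ) :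
    I ^ (r + k) = J ^ k * I ^ r := by
  induction k with
  | zero => simp
  | succ k ih => rw [← add_assoc, pow_succ, ih, mul_assoc, ← pow_succ, h, pow_succ, mul_assoc]

theorem IsReduction.exists_pow_eq {I J : Ideal R} (h : IsReduction J I) :
    ∃ r, ∀ k, I ^ (r + k) = J ^ k * I ^ r := by
  obtain ⟨r, hr⟩ := h.2
  exact ⟨r, IsReduction.pow_le hr⟩

theorem isReduction_of_le {I J : Ideal R} (hJ : J ≤ I) {r : ℕ} (h : I ^ (r + 1) ≤ J * I ^ r) :
    IsReduction J I :=
  ⟨hJ, r, le_antisymm h (by rw [pow_succ']; exact Ideal.mul_mono_left hJ)⟩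

theorem isReduction_refl (I : Ideal R) : IsReduction I I := ⟨le_rfl, 0, by simp⟩

theorem sup_pow_succ_le (J' : Ideal R) (z : R) (e : ℕ) :
    (J' ⊔ Ideal.span {z}) ^ (e + 1) ≤
      J' * (J' ⊔ Ideal.span {z}) ^ e ⊔ Ideal.span {z ^ (e + 1)} := by
  induction e with
  | zero => simp
  | succ e ih =>
    rw [pow_succ' _ (e + 1)]
    nth_rewrite 1 [Ideal.sup_mul]
    refine sup_le le_sup_left ?_
    refine (Ideal.mul_mono_right ih).trans ?_
    rw [Ideal.mul_sup, Ideal.span_singleton_mul_span_singleton, ← pow_succ' z]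
    refine sup_le_sup_right ?_ _
    rw [mul_left_comm]
    refine Ideal.mul_mono_right ?_
    rw [pow_succ' _ e]
    exact Ideal.mul_mono_left le_sup_right

theorem prod_sub_prod_mem {ι : Type*} {J J' : Ideal R} (hJ : J' ≤ J) {u v : ι → R}
    (hv : ∀ i, v i ∈ J) (h : ∀ i, u i - v i ∈ J') (s : Multiset ι) (n : ℕ)
    (hs : Multiset.card s = n + 1) :
    (s.map u).prod - (s.map v).prod ∈ J' * J ^ n := by
  induction s using Multiset.induction_on generalizing n with
  | empty => simp at hs
  | cons i s ih =>
    have hu : u i ∈ J := by simpa using J.add_mem (hJ (h i)) (hv i)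
    have hprod : (s.map v).prod ∈ J ^ Multiset.card s := by
      clear hs ih
      induction s using Multiset.induction_on with
      | empty => simp
      | cons j s ih =>
        rw [Multiset.map_cons, Multiset.prod_cons, Multiset.card_cons, pow_succ']
        exact Ideal.mul_mem_mul (hv j) ih
    have hsplit : ((i ::ₘ s).map u).prod - ((i ::ₘ s).map v).prod =
        u i * ((s.map u).prod - (s.map v).prod) + (u i - v i) * (s.map v).prod := by
      rw [Multiset.map_cons, Multiset.map_cons, Multiset.prod_cons, Multiset.prod_cons]; ring
    have hn : Multiset.card s = n := by simpa using hs
    rw [hsplit]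
    refine Ideal.add_mem _ ?_ (Ideal.mul_mem_mul (h i) (hn ▸ hprod))
    cases n with
    | zero => rw [Multiset.card_eq_zero.1 hn]; simp
    | succ n =>
      rw [pow_succ', mul_left_comm]
      exact Ideal.mul_mem_mul hu (ih n hn)

theorem eval_sub_eval_mem {ι : Type*} {J J' : Ideal R} (hJ : J' ≤ J) {u v : ι → R}
    (hv : ∀ i, v i ∈ J) (h : ∀ i, u i - v i ∈ J') {n : ℕ} {G : MvPolynomial ι R}
    (hG : G.IsHomogeneous (n + 1)) : eval u G - eval v G ∈ J' * J ^ n := by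
  classical
  rw [eval_eq, eval_eq, ← Finset.sum_sub_distrib]
  refine Ideal.sum_mem _ fun m hm => ?_
  rw [← mul_sub]
  refine Ideal.mul_mem_left _ _ ?_
  have hdeg : Multiset.card (Finsupp.toMultiset m) = n + 1 := by
    rw [Finsupp.card_toMultiset]
    by_contra hne
    exact mem_support_iff.1 hm (hG.coeff_eq_zero hne)
  have hprod : ∀ w : ι → R, ((Finsupp.toMultiset m).map w).prod = ∏ i ∈ m.support, w i ^ m i := by
    intro w
    rw [Finsupp.toMultiset_map, Finsupp.prod_toMultiset, Finsupp.prod_mapDomain_index]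
    · rfl
    · simp
    · intro a b c; rw [pow_add]
  have := prod_sub_prod_mem hJ hv h _ n hdeg
  rwa [hprod, hprod] at this

theorem eval_mul_of_isHomogeneous {ι : Type*} {G : MvPolynomial ι R} {n : ℕ}
    (hG : G.IsHomogeneous n) (w : ι → R) (z : R) :
    eval (fun i => w i * z) G = z ^ n * eval w G := by
  rw [eval_eq, eval_eq, Finset.mul_sum]
  refine Finset.sum_congr rfl fun m hm => ?_
  have hdeg : ∑ i ∈ m.support, m i = n := by
    by_contra hne
    exact mem_support_iff.1 hm (hG.coeff_eq_zero hne)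
  simp_rw [mul_pow]
  rw [Finset.prod_mul_distrib, Finset.prod_pow_eq_pow_sum, hdeg]
  ring

variable [IsLocalRing R]

/-- The elements `x i` of `I` are analytically independent: a form of degree `e` whose value at `x`
lies in `𝔪 I ^ e` has all its coefficients in `𝔪`. -/
def AnalyticallyIndependent {ι : Type*} (I : Ideal R) (x : ι → R) : Prop :=
  ∀ (e : ℕ) (G : MvPolynomial ι R), G.IsHomogeneous e → eval x G ∈ maximalIdeal R * I ^ e →
    MvPolynomial.map (residue R) G = 0

theorem map_residue_eq_zero_of_isHomogeneous_zero {ι : Type*} {I : Ideal R} {x : ι → R}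
    {G : MvPolynomial ι R} (hG : G.IsHomogeneous 0) (hx : eval x G ∈ maximalIdeal R * I ^ 0) :
    MvPolynomial.map (residue R) G = 0 := by
  rw [← totalDegree_zero_iff_isHomogeneous, totalDegree_eq_zero_iff_eq_C] at hG
  rw [hG, eval_C, pow_zero, mul_one] at hx
  rw [hG, map_C, (residue_eq_zero_iff _).2 hx, map_zero]

variable [IsNoetherianRing R]

theorem isReduction_of_le_sup {I J : Ideal R} (hJ : J ≤ I) {r : ℕ}
    (h : I ^ (r + 1) ≤ J * I ^ r ⊔ maximalIdeal R * I ^ (r + 1)) : IsReduction J I :=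
  isReduction_of_le hJ (Submodule.le_of_le_smul_of_le_jacobson_bot
    (IsNoetherian.noetherian _) (IsLocalRing.maximalIdeal_le_jacobson _) h)

/-- With `r` the exponent that works at `β`, the length of I^(r+1) modulo the specialized ideal
times I^r vanishes at `β`, so its generic value is zero as well. -/
theorem generically_isReduction {σ ι : Type*} [Finite σ] {I : Ideal R}
    (y : ι → MvPolynomial σ R) (hy : ∀ l, y l ∈ I.map C) {β : σ → R}
    (hβ : IsReduction (Ideal.span (Set.range fun l => eval β (y l))) I) :
    Generically fun α : σ → R => IsReduction (Ideal.span (Set.range fun l => eval α (y l))) I := by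
  have hmap : ∀ (α : σ → R), (Ideal.span (Set.range y)).map (eval α) =
      Ideal.span (Set.range fun l => eval α (y l)) := by
    intro α
    rw [Ideal.map_span, ← Set.range_comp]
    rfl
  have hyI : Ideal.span (Set.range y) ≤ I.map C := by
    rw [Ideal.span_le]
    rintro _ ⟨l, rfl⟩
    exact hy l
  obtain ⟨-, r, hr⟩ := hβ
  have hF : Ideal.span (Set.range y) * (I ^ r).map C ≤ (I ^ (r + 1)).map C := by
    rw [pow_succ', Ideal.map_mul]
    exact Ideal.mul_mono_left hyI
  refine (generically_quotLength_le hF).mono fun α hα => ?_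
  have h := hα β
  rw [Ideal.map_mul, Ideal.map_mul, map_eval_map_C, map_eval_map_C, hmap, hmap,
    quotLength_eq_zero_iff.2 hr.le, nonpos_iff_eq_zero, quotLength_eq_zero_iff] at h
  refine isReduction_of_le ?_ h
  have := Ideal.map_mono (f := eval α) hyI
  rwa [hmap, map_eval_map_C] at this

/-- Noether normalization, one step. With G(w) a unit, the change of variables x' = x − wz makes `G`
monic in `z` up to a unit: G(x) ≡ z^e G(w) modulo J'J^(e−1). Thus z^e ∈ J'J^(e−1) + 𝔪I^e, and
Nakayama shows that J' = (x') is already a reduction. -/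
theorem exists_isReduction_of_form [Infinite (ResidueField R)] {I : Ideal R} {c : ℕ}
    {x : Fin (c + 1) → R} (hx : IsReduction (Ideal.span (Set.range x)) I) {e : ℕ}
    {G : MvPolynomial (Fin (c + 1)) R} (hG : G.IsHomogeneous e)
    (hGx : eval x G ∈ maximalIdeal R * I ^ e) (hG0 : MvPolynomial.map (residue R) G ≠ 0) :
    ∃ x' : Fin c → R, (∀ i, x' i ∈ Ideal.span (Set.range x)) ∧
      IsReduction (Ideal.span (Set.range x')) I := by
  -- The extra factor makes the last coordinate of `w` a unit, so that `z` can be solved for and the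
  -- last `x i - w i * z` is zero.
  obtain ⟨w, hw⟩ : ∃ w : Fin (c + 1) → R, IsUnit (eval w (G * X (Fin.last c))) := by
    refine Generically.exists ⟨G * X (Fin.last c), ?_, fun _ h => h⟩
    rw [map_mul, map_X]
    exact mul_ne_zero hG0 (X_ne_zero _)
  rw [map_mul, IsUnit.mul_iff, eval_X] at hw
  obtain ⟨hGw, ⟨b, hb⟩⟩ := hw
  set J := Ideal.span (Set.range x) with hJ
  have hxJ : ∀ i, x i ∈ J := fun i => Ideal.subset_span ⟨i, rfl⟩
  let z := (↑b⁻¹ : R) * x (Fin.last c)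
  have hzJ : z ∈ J := J.mul_mem_left _ (hxJ _)
  let x' : Fin c → R := fun i => x i.castSucc - w i.castSucc * z
  have hx'J : ∀ i, x' i ∈ J := fun i => J.sub_mem (hxJ _) (J.mul_mem_left _ hzJ)
  set J' := Ideal.span (Set.range x') with hJ'
  have hJ'J : J' ≤ J := by
    rw [hJ', Ideal.span_le]
    rintro _ ⟨i, rfl⟩
    exact hx'J i
  have hdiff : ∀ i, x i - w i * z ∈ J' := by
    intro i
    refine Fin.lastCases ?_ (fun i => ?_) i
    · have : x (Fin.last c) - w (Fin.last c) * z = 0 := by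
        rw [← hb, Units.mul_inv_cancel_left, sub_self]
      rw [this]; exact J'.zero_mem
    · exact Ideal.subset_span ⟨i, rfl⟩
  have hJsup : J = J' ⊔ Ideal.span {z} := by
    refine le_antisymm ?_ (sup_le hJ'J ((Ideal.span_singleton_le_iff_mem _).2 hzJ))
    rw [hJ, Ideal.span_le]
    rintro _ ⟨i, rfl⟩
    have : x i = (x i - w i * z) + w i * z := by ring
    rw [this]
    exact Submodule.add_mem_sup (hdiff i)
      (Ideal.mul_mem_left _ _ (Ideal.mem_span_singleton_self z))
  refine ⟨x', hx'J, ?_⟩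
  obtain ⟨hJI, r, hr⟩ := hx
  cases e with
  | zero => exact absurd (map_residue_eq_zero_of_isHomogeneous_zero hG hGx) hG0
  | succ e =>
    have h1 := eval_sub_eval_mem hJ'J (v := fun i => w i * z)
      (fun i => J.mul_mem_left _ hzJ) hdiff hG
    rw [eval_mul_of_isHomogeneous hG] at h1
    have h2 : z ^ (e + 1) ∈ J' * J ^ e ⊔ maximalIdeal R * I ^ (e + 1) := by
      rw [← Ideal.mul_unit_mem_iff_mem _ hGw]
      have : z ^ (e + 1) * eval w G = -(eval x G - z ^ (e + 1) * eval w G) + eval x G := by ring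
      rw [this]
      exact Submodule.add_mem_sup (neg_mem h1) hGx
    refine isReduction_of_le_sup (hJ'J.trans hJI) (r := r + e) ?_
    have h3 : J ^ (e + 1) ≤ J' * J ^ e ⊔ maximalIdeal R * I ^ (e + 1) := by
      conv_lhs => rw [hJsup]
      refine (sup_pow_succ_le J' z e).trans ?_
      rw [← hJsup]
      exact sup_le le_sup_left ((Ideal.span_singleton_le_iff_mem _).2 h2)
    rw [add_assoc, IsReduction.pow_le hr]
    refine (Ideal.mul_mono_left h3).trans ?_
    rw [Ideal.sup_mul, mul_assoc, mul_assoc, ← pow_add, add_comm (e + 1) r,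
      ← IsReduction.pow_le hr e, IsReduction.pow_le hr (e + 1)]

theorem analyticallyIndependent_of_minimal [Infinite (ResidueField R)] {I : Ideal R} {c : ℕ}
    {x : Fin c → R} (hx : IsReduction (Ideal.span (Set.range x)) I)
    (hmin : ∀ c' < c, ∀ x' : Fin c' → R, (∀ i, x' i ∈ Ideal.span (Set.range x)) →
      ¬ IsReduction (Ideal.span (Set.range x')) I) : AnalyticallyIndependent I x := by
  intro e G hG hGx
  by_contra hG0
  cases c with
  | zero =>
    obtain rfl : e = 0 := by
      refine hG.inj_right (isHomogeneous_of_isEmpty _ _ G) ?_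
      rintro rfl
      exact hG0 (map_zero _)
    exact hG0 (map_residue_eq_zero_of_isHomogeneous_zero hG hGx)
  | succ c =>
    obtain ⟨x', hx', hred⟩ := exists_isReduction_of_form hx hG hGx hG0
    exact hmin c c.lt_succ_self x' hx' hred

/-- A family in `H` of least size generating a reduction cannot be shortened, so by
`exists_isReduction_of_form` it satisfies no form that is nonzero modulo 𝔪. -/
theorem IsReduction.exists_analyticallyIndependent [Infinite (ResidueField R)] {I H : Ideal R}
    (hH : IsReduction H I) : ∃ (c : ℕ) (x : Fin c → R), (∀ i, x i ∈ H) ∧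
      IsReduction (Ideal.span (Set.range x)) I ∧ AnalyticallyIndependent I x ∧
      ∀ (c' : ℕ) (x' : Fin c' → R), (∀ i, x' i ∈ H) →
        IsReduction (Ideal.span (Set.range x')) I → c ≤ c' := by
  classical
  have hex : ∃ (c : ℕ) (x : Fin c → R), (∀ i, x i ∈ H) ∧
      IsReduction (Ideal.span (Set.range x)) I := by
    obtain ⟨c, x, hx⟩ := Submodule.fg_iff_exists_fin_generating_family.1
      (IsNoetherian.noetherian H)
    have hx' : Ideal.span (Set.range x) = H := hx
    exact ⟨c, x, fun i => hx' ▸ Ideal.subset_span ⟨i, rfl⟩, by rwa [hx']⟩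
  obtain ⟨x, hxH, hx⟩ := Nat.find_spec hex
  refine ⟨Nat.find hex, x, hxH, hx,
    analyticallyIndependent_of_minimal hx fun c' hc' x' hx' hred => ?_,
    fun c' x' hx' hred => Nat.find_min' hex ⟨x', hx', hred⟩⟩
  refine Nat.find_min hex hc' ⟨x', fun i => ?_, hred⟩
  exact (Ideal.span_le.2 (by rintro _ ⟨i, rfl⟩; exact hxH i) : _ ≤ H) (hx' i)

end Reduction
end GenRed

namespace GenRed
open MvPolynomial

/-! ### Minimal reductions as specializations of a generic ideal -/

section Combination

variable {R : Type*} [CommRing R]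

/-- The ideal generated by the generic linear combinations of the elements `a j`. -/
noncomputable def genericCombinationIdeal {s : ℕ} (t : ℕ) (a : Fin s → R) :
    Ideal (MvPolynomial (Fin t × Fin s) R) :=
  Ideal.span (Set.range fun i : Fin t => ∑ j : Fin s, X (i, j) * C (a j))

theorem genericCombinationIdeal_map {s t : ℕ} (a : Fin s → R) (α : Fin t × Fin s → R) :
    (genericCombinationIdeal t a).map (eval α) = combinationIdeal a α := by
  rw [genericCombinationIdeal, combinationIdeal, Ideal.map_span, ← Set.range_comp]
  congr! 3 with i
  simp

theorem sum_X_mul_C_mem {s t : ℕ} (a : Fin s → R) (i : Fin t) :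
    ∑ j : Fin s, (X (i, j) : MvPolynomial (Fin t × Fin s) R) * C (a j) ∈
      (Ideal.span (Set.range a)).map C :=
  Ideal.sum_mem _ fun j _ =>
    Ideal.mul_mem_left _ _ (Ideal.mem_map_of_mem _ (Ideal.subset_span ⟨j, rfl⟩))

theorem genericCombinationIdeal_le {s : ℕ} (t : ℕ) (a : Fin s → R) :
    genericCombinationIdeal t a ≤ (Ideal.span (Set.range a)).map C := by
  rw [genericCombinationIdeal, Ideal.span_le]
  rintro _ ⟨i, rfl⟩
  exact sum_X_mul_C_mem a i

/-- An invariant of the ideals `J` that, on the ideals generated by `t` linear combinations of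
generators of `I`, is the length of a specialization of a quotient over a polynomial ring. -/
def IsSpecializedLength (I : Ideal R) (t : ℕ) (Λ : Ideal R → ℕ∞) : Prop :=
  ∀ (s : ℕ) (a : Fin s → R), Ideal.span (Set.range a) = I →
    ∃ (E : Ideal R) (F : Ideal (MvPolynomial (Fin t × Fin s) R)), F ≤ E.map C ∧
      ∀ α, Λ (combinationIdeal a α) = quotLength E (F.map (eval α))

theorem isSpecializedLength_pow (I : Ideal R) (d n : ℕ) :
    IsSpecializedLength I d fun J => quotLength (I ^ n) (J ^ n) := by
  rintro s a rfl
  refine ⟨Ideal.span (Set.range a) ^ n, genericCombinationIdeal d a ^ n, ?_, fun α => ?_⟩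
  · rw [Ideal.map_pow]
    exact Ideal.pow_right_mono (genericCombinationIdeal_le d a) n
  · rw [Ideal.map_pow, genericCombinationIdeal_map]

theorem isSpecializedLength_mul_add (I : Ideal R) (d : ℕ) {n : ℕ} (hn : 1 ≤ n) :
    IsSpecializedLength I d fun J => quotLength (I ^ n) (J * I ^ (n - 1) + I ^ (n + 1)) := by
  rintro s a rfl
  refine ⟨Ideal.span (Set.range a) ^ n,
    genericCombinationIdeal d a * (Ideal.span (Set.range a) ^ (n - 1)).map C +
    (Ideal.span (Set.range a) ^ (n + 1)).map C, ?_, fun α => ?_⟩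
  · refine sup_le ?_ (Ideal.map_mono (Ideal.pow_le_pow_right n.le_succ))
    obtain ⟨m, rfl⟩ := Nat.exists_eq_add_of_le' hn
    rw [Nat.add_sub_cancel, pow_succ' _ m, Ideal.map_mul]
    exact Ideal.mul_mono_left (genericCombinationIdeal_le d a)
  · rw [Submodule.add_eq_sup, Ideal.map_sup, Ideal.map_mul,
      genericCombinationIdeal_map, map_eval_map_C, map_eval_map_C]
    rfl

/-- Together with `isSpecializedLength_top_sup` this replaces the length of (J ∩ I²)/JI, since
intersection need not commute with specialization. -/
theorem isSpecializedLength_mul (I : Ideal R) (d : ℕ) :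
    IsSpecializedLength I d fun J => quotLength (I ^ 2) (J * I) := by
  rintro s a rfl
  refine ⟨Ideal.span (Set.range a) ^ 2,
    genericCombinationIdeal d a * (Ideal.span (Set.range a)).map C, ?_, fun α => ?_⟩
  · rw [pow_two, Ideal.map_mul]
    exact Ideal.mul_mono_left (genericCombinationIdeal_le d a)
  · rw [Ideal.map_mul, genericCombinationIdeal_map, map_eval_map_C]

theorem isSpecializedLength_top_sup (I K : Ideal R) (d : ℕ) :
    IsSpecializedLength I d fun J => quotLength ⊤ (J ⊔ K) := by
  rintro s a rfl
  refine ⟨⊤, genericCombinationIdeal d a ⊔ K.map C, ?_, fun α => ?_⟩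
  · rw [Ideal.map_top]
    exact le_top
  · rw [Ideal.map_sup, genericCombinationIdeal_map, map_eval_map_C]

theorem isSpecializedLength_sup (I : Ideal R) (d : ℕ) :
    IsSpecializedLength I d fun J => quotLength I (J ⊔ I ^ 2) := by
  rintro s a rfl
  refine ⟨Ideal.span (Set.range a),
    genericCombinationIdeal d a ⊔ (Ideal.span (Set.range a) ^ 2).map C, ?_, fun α => ?_⟩
  · exact sup_le (genericCombinationIdeal_le d a) (Ideal.map_mono (Ideal.pow_le_self two_ne_zero))
  · rw [Ideal.map_sup, genericCombinationIdeal_map, map_eval_map_C]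

variable [IsLocalRing R]

/-- Every analytically independent family generating a reduction of `I` has `d` elements. -/
def IndependentReductionsHaveCard (I : Ideal R) (d : ℕ) : Prop :=
  ∀ (c : ℕ) (x : Fin c → R), IsReduction (Ideal.span (Set.range x)) I →
    AnalyticallyIndependent I x → c = d

variable [IsNoetherianRing R] [Infinite (ResidueField R)] {I : Ideal R} {d : ℕ}

namespace IndependentReductionsHaveCard

theorem exists_mem (hI : IndependentReductionsHaveCard I d) {H : Ideal R} (hH : IsReduction H I) :
    ∃ x : Fin d → R, (∀ i, x i ∈ H) ∧ IsReduction (Ideal.span (Set.range x)) I := by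
  obtain ⟨c, x, hxH, hx, hind, -⟩ := hH.exists_analyticallyIndependent
  obtain rfl := hI c x hx hind
  exact ⟨x, hxH, hx⟩

theorem le_card (hI : IndependentReductionsHaveCard I d) {c : ℕ} {x : Fin c → R}
    (hx : IsReduction (Ideal.span (Set.range x)) I) : d ≤ c := by
  obtain ⟨c', x', -, hx', hind, hmin⟩ := hx.exists_analyticallyIndependent
  obtain rfl := hI c' x' hx' hind
  exact hmin c x (fun i => Ideal.subset_span ⟨i, rfl⟩) hx

/-- A smaller reduction `K` contains `d` elements y = Mx generating a reduction. If det M is a unit,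
then `K` contains every `x i`. Otherwise the `y i` are dependent modulo 𝔪I, one of them is
superfluous by Nakayama, and `d - 1` elements would generate a reduction. -/
theorem isMinimalReduction (hI : IndependentReductionsHaveCard I d) {x : Fin d → R}
    (hx : IsReduction (Ideal.span (Set.range x)) I) :
    IsMinimalReduction (Ideal.span (Set.range x)) I := by
  refine ⟨hx, fun K hK hKx => ?_⟩
  obtain ⟨y, hyK, hy⟩ := hI.exists_mem hK
  have hyx : ∀ i, ∃ c : Fin d → R, ∑ j, c j * x j = y i := fun i =>
    Ideal.mem_span_range_iff_exists_fun.1 (hKx (hyK i))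
  choose c hc using hyx
  let M : Matrix (Fin d) (Fin d) R := Matrix.of c
  have hM : M.mulVec x = y := funext fun i => by rw [← hc i]; rfl
  by_cases hdet : IsUnit M.det
  · have hxy : x = M⁻¹.mulVec y := by
      rw [← hM, Matrix.mulVec_mulVec, Matrix.nonsing_inv_mul _ hdet, Matrix.one_mulVec]
    rw [Ideal.span_le]
    rintro _ ⟨i, rfl⟩
    rw [hxy]
    have : M⁻¹.mulVec y i = ∑ j, M⁻¹ i j * y j := rfl
    rw [SetLike.mem_coe, this]
    exact Ideal.sum_mem _ fun j _ => K.mul_mem_left _ (hyK j)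
  · exfalso
    have hdet0 : (M.map (residue R)).det = 0 := by
      rw [← RingHom.mapMatrix_apply, ← RingHom.map_det, residue_eq_zero_iff]
      simpa using hdet
    obtain ⟨v, hv, hvM⟩ := Matrix.exists_vecMul_eq_zero_iff.2 hdet0
    choose w hw using fun j => residue_surjective (v j)
    obtain ⟨i₀, hi₀⟩ := Function.ne_iff.1 hv
    cases d with
    | zero => exact i₀.elim0
    | succ d =>
      have hwi₀ : IsUnit (w i₀) := by
        rw [← residue_ne_zero_iff_isUnit, hw]
        exact hi₀
      have hsum : ∑ i, w i * y i ∈ maximalIdeal R * I := by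
        have h1 : ∑ i, w i * y i = ∑ j, (∑ i, w i * c i j) * x j := by
          simp_rw [← hc, Finset.mul_sum, Finset.sum_mul]
          rw [Finset.sum_comm]
          simp_rw [mul_assoc]
        rw [h1]
        refine Ideal.sum_mem _ fun j _ => Ideal.mul_mem_mul ?_ (hx.1 (Ideal.subset_span ⟨j, rfl⟩))
        rw [← residue_eq_zero_iff, map_sum]
        have := congrFun hvM j
        simp only [Matrix.vecMul, dotProduct, Matrix.map_apply, Pi.zero_apply] at this
        rw [← this]
        exact Finset.sum_congr rfl fun i _ => by rw [map_mul, hw]; rfl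
      let y' : Fin d → R := fun i => y (i₀.succAbove i)
      have hy'I : Ideal.span (Set.range y') ≤ I := by
        rw [Ideal.span_le]
        rintro _ ⟨i, rfl⟩
        exact hK.1 (hyK _)
      have hyle : Ideal.span (Set.range y) ≤ Ideal.span (Set.range y') ⊔ maximalIdeal R * I := by
        rw [Ideal.span_le]
        rintro _ ⟨i, rfl⟩
        rcases Fin.eq_self_or_eq_succAbove i₀ i with rfl | ⟨j, rfl⟩
        · have h2 : w i * y i = -(∑ j, w (i.succAbove j) * y' j) + ∑ i, w i * y i := by
            rw [Fin.sum_univ_succAbove _ i]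
            simp only [y']
            ring
          rw [SetLike.mem_coe, ← Ideal.unit_mul_mem_iff_mem _ hwi₀, h2]
          refine Submodule.add_mem_sup (neg_mem ?_) hsum
          exact Ideal.sum_mem _ fun j _ =>
            Ideal.mul_mem_left _ _ (Ideal.subset_span ⟨j, rfl⟩)
        · exact Ideal.mem_sup_left (Ideal.subset_span ⟨j, rfl⟩)
      obtain ⟨-, r, hr⟩ := hy
      have hy' : IsReduction (Ideal.span (Set.range y')) I := by
        refine isReduction_of_le_sup hy'I (r := r) ?_
        rw [hr]
        refine (Ideal.mul_mono_left hyle).trans ?_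
        rw [Ideal.sup_mul, mul_assoc, ← pow_succ', hr]
      have := hI.le_card hy'
      omega

/-- This is why bounds over all parameters become bounds over all minimal reductions: `d` elements
of `H` generate a reduction, and minimality makes it equal to `H`. -/
theorem exists_combinationIdeal (hI : IndependentReductionsHaveCard I d) {s : ℕ} {a : Fin s → R}
    (ha : Ideal.span (Set.range a) = I) {H : Ideal R} (hH : IsMinimalReduction H I) :
    ∃ α : Fin d × Fin s → R, H = combinationIdeal a α := by
  obtain ⟨x, hxH, hx⟩ := hI.exists_mem hH.1
  have hxH' : Ideal.span (Set.range x) ≤ H := Ideal.span_le.2 (by rintro _ ⟨i, rfl⟩; exact hxH i)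
  have hxa : ∀ i, ∃ c : Fin s → R, ∑ j, c j * a j = x i := fun i =>
    Ideal.mem_span_range_iff_exists_fun.1 (ha ▸ hH.1.1 (hxH i))
  choose c hc using hxa
  refine ⟨fun ij => c ij.1 ij.2, ?_⟩
  rw [combinationIdeal]
  simp_rw [hc]
  exact le_antisymm (hH.2 hx hxH') hxH'

theorem exists_isMinimalReduction (hI : IndependentReductionsHaveCard I d) :
    ∃ J, IsMinimalReduction J I := by
  obtain ⟨x, -, hx⟩ := hI.exists_mem (isReduction_refl I)
  exact ⟨_, hI.isMinimalReduction hx⟩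

theorem generically_isMinimalReduction (hI : IndependentReductionsHaveCard I d) {s : ℕ}
    {a : Fin s → R} (ha : Ideal.span (Set.range a) = I) :
    Generically fun α : Fin d × Fin s → R => IsMinimalReduction (combinationIdeal a α) I := by
  obtain ⟨J, hJ⟩ := hI.exists_isMinimalReduction
  obtain ⟨β, rfl⟩ := hI.exists_combinationIdeal ha hJ
  have heval : ∀ α : Fin d × Fin s → R,
      Ideal.span (Set.range fun i : Fin d => eval α (∑ j, X (i, j) * C (a j))) =
        combinationIdeal a α := by
    intro α
    rw [combinationIdeal]
    congr! 3 with i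
    simp
  have := generically_isReduction (I := I) (fun i : Fin d => ∑ j, X (i, j) * C (a j))
    (fun i => ha ▸ sum_X_mul_C_mem a i) (β := β) (by rw [heval]; exact hJ.1)
  refine this.mono fun α hα => ?_
  rw [heval] at hα
  exact hI.isMinimalReduction hα

end IndependentReductionsHaveCard

namespace IsSpecializedLength

variable {Λ : Ideal R → ℕ∞}

theorem generically_le (hΛ : IsSpecializedLength I d Λ) (hI : IndependentReductionsHaveCard I d)
    {s : ℕ} {a : Fin s → R} (ha : Ideal.span (Set.range a) = I) :
    Generically fun α : Fin d × Fin s → R =>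
      ∀ H, IsMinimalReduction H I → Λ (combinationIdeal a α) ≤ Λ H := by
  obtain ⟨E, F, hF, h⟩ := hΛ s a ha
  refine (generically_quotLength_le hF).mono fun α hα H hH => ?_
  obtain ⟨β, rfl⟩ := hI.exists_combinationIdeal ha hH
  rw [h, h]
  exact hα β

/-- General minimal reductions built from different generating families give the same value of `Λ`,
since each attains the minimum over all minimal reductions. A single `H` of finite value makes that
minimum finite. -/
theorem exists_forGeneral_eq (hΛ : IsSpecializedLength I d Λ)
    (hI : IndependentReductionsHaveCard I d) {H : Ideal R} (hH : IsMinimalReduction H I)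
    (hfin : Λ H ≠ ⊤) :
    ∃ δ : ℕ, ForGeneralMinimalReduction I d fun J => Λ J = δ := by
  obtain ⟨s, a, ha'⟩ := Submodule.fg_iff_exists_fin_generating_family.1 (IsNoetherian.noetherian I)
  have ha : Ideal.span (Set.range a) = I := ha'
  obtain ⟨α, hα, hαΛ⟩ := ((hI.generically_isMinimalReduction ha).and
    (hΛ.generically_le hI ha)).exists
  have hne : Λ (combinationIdeal a α) ≠ ⊤ := ne_top_of_le_ne_top hfin (hαΛ H hH)
  refine ⟨(Λ (combinationIdeal a α)).toNat, forGeneralMinimalReduction_of_generically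
    fun s b hb => ?_⟩
  refine ((hI.generically_isMinimalReduction hb).and (hΛ.generically_le hI hb)).mono ?_
  rintro β ⟨hβ, hβΛ⟩
  refine ⟨hβ, ?_⟩
  rw [ENat.natCast_toNat hne]
  exact le_antisymm (hβΛ _ hα) (hαΛ _ hβ)

end IsSpecializedLength

end Combination
end GenRed

namespace GenRed

/-! ### Basic elements and the condition `G_d` -/

section LocalGenerators

variable {R : Type*} [CommRing R]

/-- At the prime `p`, the ideal `I` is generated modulo `K` by `j` elements. -/
def GeneratedAt (I K p : Ideal R) (j : ℕ) : Prop :=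
  ∃ y : Fin j → R, (∀ l, y l ∈ I) ∧ ∃ s ∉ p, Ideal.span {s} * I ≤ K ⊔ Ideal.span (Set.range y)

theorem GeneratedAt.mono {I K K' p : Ideal R} {j : ℕ} (h : GeneratedAt I K p j) (hK : K ≤ K') :
    GeneratedAt I K' p j := by
  obtain ⟨y, hy, s, hs, hsI⟩ := h
  exact ⟨y, hy, s, hs, hsI.trans (sup_le_sup_right hK _)⟩

/-- The ideal defining the locus where `I` is not generated modulo `K` by `j` elements. -/
def generatedAtIdeal (I K : Ideal R) (j : ℕ) : Ideal R :=
  Ideal.span {s | ∃ y : Fin j → R, (∀ l, y l ∈ I) ∧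
    Ideal.span {s} * I ≤ K ⊔ Ideal.span (Set.range y)}

theorem generatedAtIdeal_le_iff {I K p : Ideal R} {j : ℕ} :
    generatedAtIdeal I K j ≤ p ↔ ¬ GeneratedAt I K p j := by
  rw [generatedAtIdeal, Ideal.span_le]
  constructor
  · rintro h ⟨y, hy, s, hs, hsI⟩
    exact hs (h ⟨y, hy, hsI⟩)
  · rintro h s ⟨y, hy, hsI⟩
    by_contra hs
    exact h ⟨y, hy, s, hs, hsI⟩

theorem generatedAt_of_mul_mem {I K K' p : Ideal R} [hp : p.IsPrime] {j : ℕ} {y : Fin (j + 1) → R}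
    (hy : ∀ l, y l ∈ I) {s : R} (hs : s ∉ p)
    (hsI : Ideal.span {s} * I ≤ K ⊔ Ideal.span (Set.range y)) (hK : K ≤ K') (l : Fin (j + 1))
    {u : R} (hu : u ∉ p)
    (huy : u * y l ∈ K' ⊔ Ideal.span (Set.range fun i => y (l.succAbove i))) :
    GeneratedAt I K' p j := by
  refine ⟨fun i => y (l.succAbove i), fun i => hy _, u * s,
    fun h => (hp.mem_or_mem h).elim hu hs, ?_⟩
  rw [← Ideal.span_singleton_mul_span_singleton, mul_assoc]
  refine (Ideal.mul_mono_right hsI).trans ?_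
  rw [Ideal.mul_sup, sup_le_iff]
  refine ⟨Ideal.mul_le_right.trans (hK.trans le_sup_left), ?_⟩
  rw [Ideal.span_mul_span', Ideal.span_le]
  rintro _ ⟨a, rfl, _, ⟨i, rfl⟩, rfl⟩
  rcases Fin.eq_self_or_eq_succAbove l i with rfl | ⟨i, rfl⟩
  · exact huy
  · exact Ideal.mem_sup_right (Ideal.mul_mem_left _ _ (Ideal.subset_span ⟨i, rfl⟩))

/-- An element of `I` whose image in I/K at `p` is a minimal generator lowers the number of
generators by one. `W` is the ideal of elements that some `s ∉ p` multiplies into K + p(y); if it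
contained `I`, then `y 0` could be dropped. -/
theorem exists_generatedAt_of_notMem {I K p : Ideal R} [hp : p.IsPrime] {j : ℕ}
    (h : GeneratedAt I K p (j + 1)) (h' : ¬ GeneratedAt I K p j) :
    ∃ W : Ideal R, ¬ I ≤ W ∧ ∀ x ∈ I, x ∉ W → GeneratedAt I (K ⊔ Ideal.span {x}) p j := by
  obtain ⟨y, hy, s, hs, hsI⟩ := h
  refine ⟨Submodule.comap (LinearMap.mulLeft R s) (K ⊔ p * Ideal.span (Set.range y)), fun hle => h' ?_,
    fun x hx hxW => ?_⟩
  · have h0 : s * y 0 ∈ K ⊔ p * Ideal.span (Set.range y) := hle (hy 0)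
    obtain ⟨κ, hκ, w, hw, hκw⟩ := Submodule.mem_sup.1 h0
    obtain ⟨c, hc, hcw⟩ : ∃ c : Fin (j + 1) → R, (∀ l, c l ∈ p) ∧ ∑ l, c l * y l = w := by
      have := (Submodule.mem_ideal_smul_span_iff_exists_sum p y w).1 hw
      obtain ⟨c, hc, hcw⟩ := this
      exact ⟨c, hc, by rw [← hcw, Finsupp.sum_fintype _ _ (by simp)]; rfl⟩
    -- The coefficient `c 0` of `y 0` lies in `p`, so moving it to the left keeps the multiplier
    -- outside `p`.
    refine generatedAt_of_mul_mem hy hs hsI le_rfl 0 (u := s - c 0)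
      (fun h => hs (by simpa using p.add_mem h (hc 0))) ?_
    have h1 : (s - c 0) * y 0 = κ + ∑ i : Fin j, c i.succ * y i.succ := by
      rw [sub_mul, ← hκw, ← hcw, Fin.sum_univ_succ]; ring
    rw [h1]
    exact Submodule.add_mem_sup hκ (Ideal.sum_mem _ fun i _ =>
      Ideal.mul_mem_left _ _ (Ideal.subset_span ⟨i, rfl⟩))
  · obtain ⟨κ, hκ, w, hw, hκw⟩ := Submodule.mem_sup.1
      (hsI (Ideal.mul_mem_mul (Ideal.mem_span_singleton_self s) hx))
    obtain ⟨c, rfl⟩ := Ideal.mem_span_range_iff_exists_fun.1 hw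
    obtain ⟨l, hl⟩ : ∃ l, c l ∉ p := by
      by_contra! hcon
      refine hxW ?_
      change s * x ∈ K ⊔ p * Ideal.span (Set.range y)
      rw [← hκw]
      exact Submodule.add_mem_sup hκ (Ideal.sum_mem _ fun l _ =>
        Ideal.mul_mem_mul (hcon l) (Ideal.subset_span ⟨l, rfl⟩))
    refine generatedAt_of_mul_mem hy hs hsI le_sup_left l hl ?_
    have h1 : c l * y l = (-κ + s * x) + -∑ i : Fin j, c (l.succAbove i) * y (l.succAbove i) := by
      rw [← hκw, Fin.sum_univ_succAbove _ l]; ring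
    rw [h1]
    refine Submodule.add_mem_sup (Submodule.add_mem_sup (neg_mem hκ)
      (Ideal.mul_mem_left _ _ (Ideal.mem_span_singleton_self x))) (neg_mem ?_)
    exact Ideal.sum_mem _ fun i _ => Ideal.mul_mem_left _ _ (Ideal.subset_span ⟨i, rfl⟩)

variable [IsLocalRing R]

/-- If finitely many subgroups cover `I`, one of them has finite index. But for `x ∉ W i` the
multiples of `x` by lifts of distinct residue classes are pairwise incongruent modulo `W i`, and
there are infinitely many. -/
theorem exists_mem_forall_notMem [Infinite (ResidueField R)] {ι : Type*} (s : Finset ι)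
    (I : Ideal R) (W : ι → Ideal R)
    (hW : ∀ i ∈ s, ¬ I ≤ W i) : ∃ x ∈ I, ∀ i ∈ s, x ∉ W i := by
  by_contra! hcon
  obtain ⟨i, hi, hfin⟩ := Submodule.exists_finiteIndex_of_cover (s := s)
    (p := fun i => Submodule.submoduleOf (W i) I) (by
      rw [Set.eq_univ_iff_forall]
      rintro ⟨x, hx⟩
      obtain ⟨i, hi, hxi⟩ := hcon x hx
      exact Set.mem_biUnion hi hxi)
  obtain ⟨x, hxI, hxW⟩ := SetLike.not_le_iff_exists.1 (hW i hi)
  choose t ht using fun v : ResidueField R => residue_surjective v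
  have : Finite (I ⧸ (Submodule.submoduleOf (W i) I).toAddSubgroup) :=
    AddSubgroup.finite_quotient_of_finiteIndex
  refine not_injective_infinite_finite (fun v : ResidueField R =>
    (QuotientAddGroup.mk (t v • (⟨x, hxI⟩ : I)) :
      I ⧸ (Submodule.submoduleOf (W i) I).toAddSubgroup)) fun v w hvw => ?_
  by_contra hne
  have hunit : IsUnit (t w - t v) := by
    rw [← residue_ne_zero_iff_isUnit, map_sub, ht, ht, sub_ne_zero]
    exact Ne.symm hne
  rw [QuotientAddGroup.eq] at hvw
  have hmem : -(t v * x) + t w * x ∈ W i := hvw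
  refine hxW ((Ideal.unit_mul_mem_iff_mem (W i) hunit).1 ?_)
  convert hmem using 1
  ring

variable [IsNoetherianRing R]

/-- Away from the maximal ideal, `I` is generated modulo `K` by at most `ht p - i` elements. -/
def GeneratedBelowHeight (I K : Ideal R) (i : ℕ) : Prop :=
  ∀ p : Ideal R, p.IsPrime → p ≠ maximalIdeal R →
    ∃ j : ℕ, GeneratedAt I K p j ∧ (j = 0 ∨ ((j + i : ℕ) : ℕ∞) ≤ p.height)

/-- Only the primes where the height bound is sharp need attention, and these are finitely many,
being minimal over one of the ideals `generatedAtIdeal I K j`. One element of `I` can be a minimal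
generator at all of them simultaneously. -/
theorem GeneratedBelowHeight.exists_succ [Infinite (ResidueField R)] {I K : Ideal R} {i : ℕ}
    (h : GeneratedBelowHeight I K i) :
    ∃ x ∈ I, GeneratedBelowHeight I (K ⊔ Ideal.span {x}) (i + 1) := by
  classical
  obtain ⟨D, hD⟩ : ∃ D : ℕ, (maximalIdeal R).height = D :=
    ENat.ne_top_iff_exists.1 (Ideal.height_ne_top_of_isPrime (I := maximalIdeal R)) |>.imp
      fun _ h => h.symm
  let 𝒞 : Set (Ideal R) := {p | ∃ j : ℕ, p.IsPrime ∧ GeneratedAt I K p (j + 1) ∧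
    ¬ GeneratedAt I K p j ∧ p.height = ((j + 1 + i : ℕ) : ℕ∞) ∧ p ≠ maximalIdeal R}
  have hfin : 𝒞.Finite := by
    refine Set.Finite.subset (Set.Finite.biUnion (Finset.range D).finite_toSet fun j _ =>
      Ideal.finite_minimalPrimes_of_isNoetherianRing R (generatedAtIdeal I K j)) ?_
    rintro p ⟨j, hp, -, hj, hht, hpm⟩
    refine Set.mem_biUnion (x := j) ?_ ?_
    · have h1 : p.height ≤ D := hD ▸ Ideal.height_mono (le_maximalIdeal hp.ne_top)
      rw [hht] at h1
      have := Nat.cast_le.1 h1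
      simp only [Finset.coe_range, Set.mem_Iio]
      omega
    · refine ⟨⟨hp, generatedAtIdeal_le_iff.2 hj⟩, ?_⟩
      rintro q ⟨hq, hqj⟩ hqp
      have hqm : q ≠ maximalIdeal R := by
        rintro rfl
        exact hpm ((le_maximalIdeal hp.ne_top).antisymm hqp)
      obtain ⟨j', hj', hj'q⟩ := h q hq hqm
      have hjj' : j < j' := by
        by_contra hle
        push Not at hle
        refine generatedAtIdeal_le_iff.1 hqj ?_
        obtain ⟨y, hy, s, hs, hsI⟩ := hj'
        -- At most `j` generators are padded with zeros to exactly `j`, contradicting the choice of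
        -- `q`.
        refine ⟨fun l => if hl : l.1 < j' then y ⟨l, hl⟩ else 0, fun l => ?_, s, hs,
          hsI.trans (sup_le_sup_left (Ideal.span_mono ?_) _)⟩
        · dsimp only
          split_ifs
          · exact hy _
          · exact I.zero_mem
        · rintro _ ⟨l, rfl⟩
          exact ⟨⟨l, by omega⟩, by simp⟩
      have h2 : p.height ≤ q.height := by
        rw [hht]
        rcases hj'q with rfl | hj'q
        · omega
        · exact le_trans (by exact_mod_cast (by omega)) hj'q
      exact (Ideal.eq_of_le_of_height_le q hqp h2).ge
  have hW : ∀ p : Ideal R, ∃ W : Ideal R, p ∈ 𝒞 → ¬ I ≤ W ∧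
      ∀ x ∈ I, x ∉ W → ∃ j : ℕ, GeneratedAt I (K ⊔ Ideal.span {x}) p j ∧
        p.height = ((j + 1 + i : ℕ) : ℕ∞) := by
    intro p
    by_cases hp : p ∈ 𝒞
    · obtain ⟨j, hpp, hj1, hj, hht, -⟩ := hp
      obtain ⟨W, hIW, hW⟩ := exists_generatedAt_of_notMem hj1 hj
      exact ⟨W, fun _ => ⟨hIW, fun x hx hxW => ⟨j, hW x hx hxW, hht⟩⟩⟩
    · exact ⟨⊥, fun h => absurd h hp⟩
  choose W hW using hW
  obtain ⟨x, hxI, hx⟩ := exists_mem_forall_notMem hfin.toFinset I W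
    fun p hp => (hW p (hfin.mem_toFinset.1 hp)).1
  refine ⟨x, hxI, fun p hp hpm => ?_⟩
  have hex := h p hp hpm
  have hex' : ∃ j, GeneratedAt I K p j := hex.imp fun _ h => h.1
  by_cases hp𝒞 : p ∈ 𝒞
  · obtain ⟨j, hj, hht⟩ := (hW p hp𝒞).2 x hxI (hx p (hfin.mem_toFinset.2 hp𝒞))
    refine ⟨j, hj, Or.inr ?_⟩
    rw [hht]
    exact_mod_cast (by omega)
  -- Outside `𝒞` the least number of generators is zero or satisfies the height bound with room to
  -- spare, so it also works for `i + 1`.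
  · refine ⟨Nat.find hex', (Nat.find_spec hex').mono le_sup_left, ?_⟩
    by_contra! hcon
    obtain ⟨j, hj⟩ := Nat.exists_eq_succ_of_ne_zero hcon.1
    obtain ⟨j', hj', hj'p⟩ := hex
    have hle : Nat.find hex' ≤ j' := Nat.find_min' hex' hj'
    have hspec := Nat.find_spec hex'
    rw [hj] at hspec
    refine hp𝒞 ⟨j, hp, hspec, Nat.find_min hex' (by omega), ?_, hpm⟩
    have h3 : ((j + 1 + i : ℕ) : ℕ∞) ≤ p.height := by
      rcases hj'p with rfl | hj'p
      · omega
      · exact le_trans (by exact_mod_cast (by omega)) hj'p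
    refine le_antisymm ?_ h3
    rw [hj] at hcon
    refine Order.le_of_lt_add_one ?_
    refine hcon.2.trans_eq ?_
    push_cast
    ring

theorem GeneratedBelowHeight.exists_family [Infinite (ResidueField R)] {I K : Ideal R}
    (h : GeneratedBelowHeight I K 0)
    (i : ℕ) : ∃ x : Fin i → R, (∀ l, x l ∈ I) ∧
      GeneratedBelowHeight I (K ⊔ Ideal.span (Set.range x)) i := by
  induction i with
  | zero => exact ⟨Fin.elim0, fun l => l.elim0, by simpa using h⟩
  | succ i ih =>
    obtain ⟨x, hx, hxK⟩ := ih
    obtain ⟨z, hz, hzK⟩ := hxK.exists_succ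
    refine ⟨Fin.cons z x, fun l => ?_, ?_⟩
    · refine Fin.cases ?_ (fun l => ?_) l
      · simpa using hz
      · simpa using hx l
    · rwa [Fin.range_cons, Ideal.span_insert, sup_comm (Ideal.span {z}), ← sup_assoc]

/-- A prime other than 𝔪 has height below `d`, which leaves only zero generators: (I + K)/K vanishes
on the punctured spectrum, so a power of 𝔪 annihilates it. -/
theorem GeneratedBelowHeight.exists_pow_mul_le {I K : Ideal R} {d : ℕ}
    (h : GeneratedBelowHeight I K d) (hd : ringKrullDim R = d) :
    ∃ c : ℕ, maximalIdeal R ^ c * I ≤ K := by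
  have hrad : maximalIdeal R ≤ (generatedAtIdeal I K 0).radical := by
    rw [Ideal.radical_eq_sInf]
    refine le_sInf ?_
    rintro p ⟨hp0, hp⟩
    by_contra hne
    have hpm : p ≠ maximalIdeal R := by rintro rfl; exact hne le_rfl
    obtain ⟨j, hj, hj'⟩ := h p hp hpm
    have hlt : p.height < d := by
      have h1 := Ideal.height_strict_mono_of_isPrime
        (lt_of_le_of_ne (le_maximalIdeal hp.ne_top) hpm)
      have h2 : ((maximalIdeal R).height : WithBot ℕ∞) = ((d : ℕ∞) : WithBot ℕ∞) := by
        rw [maximalIdeal_height_eq_ringKrullDim, hd]; rfl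
      rwa [WithBot.coe_inj.1 h2] at h1
    rcases hj' with rfl | hj'
    · exact generatedAtIdeal_le_iff.1 hp0 hj
    · have := hj'.trans_lt hlt
      rw [Nat.cast_lt] at this
      omega
  obtain ⟨c, hc⟩ := Ideal.exists_pow_le_of_le_radical_of_fg hrad (IsNoetherian.noetherian _)
  refine ⟨c, (Ideal.mul_mono_left hc).trans ?_⟩
  rw [generatedAtIdeal, Ideal.mul_le]
  intro s hs x hx
  refine Submodule.span_induction ?_ ?_ ?_ ?_ hs
  · rintro t ⟨y, -, ht⟩
    have := ht (Ideal.mul_mem_mul (Ideal.mem_span_singleton_self t) hx)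
    simpa using this
  · simp
  · intro a b _ _ ha hb
    rw [add_mul]
    exact K.add_mem ha hb
  · intro r a _ ha
    rw [smul_eq_mul, mul_assoc]
    exact K.mul_mem_left _ ha

/-- Working modulo I² disposes of the primes not containing `I`, about which `G_d` says nothing:
there I and I² agree locally, and no generator is needed. -/
theorem SatisfiesG.generatedBelowHeight {I : Ideal R} {d : ℕ}
    (h : SatisfiesG I d) (hd : ringKrullDim R = d) : GeneratedBelowHeight I (I ^ 2) 0 := by
  intro p hp hpm
  by_cases hIp : I ≤ p
  · have hlt : p.height < d := by
      have h1 := Ideal.height_strict_mono_of_isPrime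
        (lt_of_le_of_ne (le_maximalIdeal hp.ne_top) hpm)
      have h2 : ((maximalIdeal R).height : WithBot ℕ∞) = ((d : ℕ∞) : WithBot ℕ∞) := by
        rw [maximalIdeal_height_eq_ringKrullDim, hd]; rfl
      rwa [WithBot.coe_inj.1 h2] at h1
    obtain ⟨i, hi⟩ := ENat.ne_top_iff_exists.1 hlt.ne_top
    rw [← hi, Nat.cast_lt] at hlt
    obtain ⟨f, hf⟩ := h p hIp i
      (by rw [IsLocalization.AtPrime.ringKrullDim_eq_height p, ← hi]; rfl) hlt
    have hfI : ∀ l, ∃ y ∈ I, ∃ t : p.primeCompl,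
        f l * algebraMap R (Localization.AtPrime p) t = algebraMap R _ y := by
      intro l
      obtain ⟨⟨y, t⟩, hyt⟩ := (IsLocalization.mem_map_algebraMap_iff p.primeCompl _).1
        (hf ▸ Ideal.subset_span ⟨l, rfl⟩ : f l ∈ I.map (algebraMap R (Localization.AtPrime p)))
      exact ⟨y, y.2, t, hyt⟩
    choose y hyI t ht using hfI
    have hspan : I.map (algebraMap R (Localization.AtPrime p)) ≤
        (Ideal.span (Set.range y)).map (algebraMap R (Localization.AtPrime p)) := by
      rw [← hf, Ideal.span_le]
      rintro _ ⟨l, rfl⟩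
      rw [SetLike.mem_coe, ← Ideal.mul_unit_mem_iff_mem _ (IsLocalization.map_units _ (t l)), ht]
      exact Ideal.mem_map_of_mem _ (Ideal.subset_span ⟨l, rfl⟩)
    obtain ⟨s, hs, hsI⟩ := exists_notMem_mul_le_of_le_saturation (P := p) (E := ⊤) (K := I)
      (N := Ideal.span (Set.range y)) (IsNoetherian.noetherian _) (by
        intro x hx
        obtain ⟨m, hm, hmx⟩ := (IsLocalization.algebraMap_mem_map_algebraMap_iff p.primeCompl _ _ _).1
          (hspan (Ideal.mem_map_of_mem _ hx))
        exact ⟨trivial, m, hm, hmx⟩)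
    exact ⟨i, ⟨y, hyI, s, hs, hsI.trans le_sup_right⟩, Or.inr (by rw [← hi]; rfl)⟩
  · obtain ⟨s, hsI, hsp⟩ := SetLike.not_le_iff_exists.1 hIp
    refine ⟨0, ⟨Fin.elim0, fun l => l.elim0, s, hsp, ?_⟩, Or.inl rfl⟩
    refine le_trans ?_ le_sup_left
    rw [pow_two]
    exact Ideal.mul_mono_left ((Ideal.span_singleton_le_iff_mem _).2 hsI)

/-- For a `G_d` ideal of a `d`-dimensional local ring, some `d` elements generate `I` up to finite
length, modulo `I ^ 2`. -/
theorem SatisfiesG.exists_pow_mul_le [Infinite (ResidueField R)] {I : Ideal R} {d : ℕ}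
    (h : SatisfiesG I d) (hd : ringKrullDim R = d) : ∃ (x : Fin d → R) (c : ℕ), (∀ l, x l ∈ I) ∧
      maximalIdeal R ^ c * I ≤ Ideal.span (Set.range x) ⊔ I ^ 2 := by
  obtain ⟨x, hx, hxd⟩ := (h.generatedBelowHeight hd).exists_family d
  obtain ⟨c, hc⟩ := hxd.exists_pow_mul_le hd
  exact ⟨x, c, hx, by rwa [sup_comm] at hc⟩

end LocalGenerators
end GenRed

namespace GenRed

/-! ### Krull dimension of integral extensions -/

section Integral

theorem ringKrullDim_eq_of_isIntegral {A B : Type*} [CommRing A] [CommRing B] {f : A →+* B}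
    (hf : f.IsIntegral) (hinj : Function.Injective f) : ringKrullDim A = ringKrullDim B := by
  algebraize [f]
  refine le_antisymm ?_ ?_
  · refine iSup_le fun l => ?_
    obtain ⟨Q, -, hQ, hQl⟩ := Ideal.exists_ideal_over_prime_of_isIntegral l.head.asIdeal
      (⊥ : Ideal B) (by
        have : RingHom.ker (algebraMap A B) = ⊥ := (RingHom.injective_iff_ker_eq_bot _).1 hinj
        rw [← RingHom.ker_eq_comap_bot, this]
        exact bot_le)
    have : Q.LiesOver l.head.asIdeal := ⟨hQl.symm⟩
    obtain ⟨L, hL, -, -⟩ := Ideal.exists_ltSeries_of_hasGoingUp l Q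
    rw [← hL]
    exact le_iSup (fun L : LTSeries (PrimeSpectrum B) => (L.length : WithBot ℕ∞)) L
  · refine Order.krullDim_le_of_strictMono (PrimeSpectrum.comap (algebraMap A B)) ?_
    intro P Q hPQ
    exact Ideal.IsIntegral.comap_lt_comap hPQ

theorem ringKrullDim_eq_of_ker_eq {A A' B : Type*} [CommRing A] [CommRing A'] [CommRing B]
    {p : A →+* A'} (hp : Function.Surjective p) {ψ : A →+* B} (hψ : ψ.IsIntegral)
    (hker : RingHom.ker ψ = RingHom.ker p) : ringKrullDim A' = ringKrullDim B := by
  let f : A' →+* B := RingHom.liftOfSurjective p hp ⟨ψ, hker.ge⟩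
  have hfp : f.comp p = ψ := RingHom.liftOfRightInverse_comp _ _ _ ⟨ψ, hker.ge⟩
  refine ringKrullDim_eq_of_isIntegral (f := f) ?_ ?_
  · refine RingHom.IsIntegral.tower_top p f ?_
    rwa [hfp]
  · rw [injective_iff_map_eq_zero]
    intro a ha
    obtain ⟨a, rfl⟩ := hp a
    rw [← RingHom.comp_apply, hfp, ← RingHom.mem_ker, hker, RingHom.mem_ker] at ha
    exact ha

theorem ringKrullDim_quotient_eq {A A' B : Type*} [CommRing A] [CommRing A'] [CommRing B]
    {p : A →+* A'} (hp : Function.Surjective p) {ψ : A →+* B} (hψ : ψ.IsIntegral) {𝔟 : Ideal B}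
    (hker : RingHom.ker ((Ideal.Quotient.mk 𝔟).comp ψ) = RingHom.ker p) :
    ringKrullDim (B ⧸ 𝔟) = ringKrullDim A' :=
  (ringKrullDim_eq_of_ker_eq hp (hψ.trans _ _
    (RingHom.isIntegral_of_surjective _ Ideal.Quotient.mk_surjective)) hker).symm

end Integral

/-! ### Analytic spread and the special fiber ring -/

section FiberRing

variable {R : Type*} [CommRing R] {I : Ideal R} {c : ℕ} {x : Fin c → R}

open MvPolynomial

/-- The monomial `b tⁿ` of the Rees algebra of `I`, for `b ∈ I ^ n`. -/
noncomputable def reesMonomial (I : Ideal R) (n : ℕ) (b : R) (hb : b ∈ I ^ n) : reesAlgebra I :=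
  ⟨Polynomial.monomial n b, reesAlgebra.monomial_mem.2 hb⟩

/-- The map from the polynomial ring to the Rees algebra that sends the variables to the elements
`xᵢ t`. -/
noncomputable def reesMap (I : Ideal R) (x : Fin c → R) (hx : ∀ i, x i ∈ I) :
    MvPolynomial (Fin c) R →ₐ[R] reesAlgebra I :=
  aeval fun i => reesMonomial I 1 (x i) (by simpa using hx i)

theorem coe_reesMap_of_isHomogeneous (hx : ∀ i, x i ∈ I) {n : ℕ} {G : MvPolynomial (Fin c) R}
    (hG : G.IsHomogeneous n) :
    (reesMap I x hx G : Polynomial R) = Polynomial.monomial n (eval x G) := by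
  have h1 : (reesMap I x hx G : Polynomial R) =
      eval (fun i => Polynomial.C (x i) * Polynomial.X) (MvPolynomial.map Polynomial.C G) := by
    have : (reesAlgebra I).val.comp (reesMap I x hx) =
        aeval (fun i => Polynomial.C (x i) * Polynomial.X) := by
      refine MvPolynomial.algHom_ext fun i => ?_
      simp [reesMap, reesMonomial, Polynomial.C_mul_X_eq_monomial]
    rw [eval_map]
    exact DFunLike.congr_fun this G
  rw [h1, eval_mul_of_isHomogeneous (hG.map _), eval_map, Polynomial.X_pow_mul,
    ← Polynomial.C_mul_X_pow_eq_monomial]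
  congr 1
  rw [← MvPolynomial.eval₂_id (p := G), MvPolynomial.hom_eval₂]
  rfl

theorem coeff_reesMap (hx : ∀ i, x i ∈ I) (P : MvPolynomial (Fin c) R) (e : ℕ) :
    (reesMap I x hx P : Polynomial R).coeff e = eval x (homogeneousComponent e P) := by
  conv_lhs => rw [← sum_homogeneousComponent P]
  rw [map_sum, AddSubmonoidClass.coe_finsetSum, Polynomial.finsetSum_coeff]
  simp_rw [coe_reesMap_of_isHomogeneous hx (homogeneousComponent_isHomogeneous _ P),
    Polynomial.coeff_monomial]
  rw [Finset.sum_ite_eq' (Finset.range (P.totalDegree + 1)) e]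
  split_ifs with h
  · rfl
  · rw [homogeneousComponent_eq_zero _ _ (by simpa using h), map_zero]

theorem coeff_mem_of_mem_map (K : Ideal R) {f : reesAlgebra I}
    (hf : f ∈ K.map (algebraMap R (reesAlgebra I))) (e : ℕ) :
    (f : Polynomial R).coeff e ∈ K * I ^ e := by
  induction hf using Submodule.span_induction generalizing e with
  | mem f hf =>
    obtain ⟨a, ha, rfl⟩ := hf
    change (Polynomial.C a).coeff e ∈ _
    rw [Polynomial.coeff_C]
    split_ifs with h
    · rw [h, pow_zero, mul_one]; exact ha
    · exact Ideal.zero_mem _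
  | zero => simp
  | add f g _ _ hf hg => simpa using Ideal.add_mem _ (hf e) (hg e)
  | smul g f _ hf =>
    change ((g : Polynomial R) * (f : Polynomial R)).coeff e ∈ _
    rw [Polynomial.coeff_mul]
    refine Ideal.sum_mem _ fun ij hij => ?_
    rw [← Finset.HasAntidiagonal.mem_antidiagonal.1 hij, pow_add, mul_left_comm]
    exact Ideal.mul_mem_mul (g.2 ij.1) (hf ij.2)

/-- Beyond degree `r` each graded piece of the Rees algebra is the previous one multiplied by the
`xᵢ t`, so an additive submonoid stable under `R[X]` and reaching degrees up to `r` reaches every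
degree. -/
theorem exists_coe_eq_monomial (hx : ∀ i, x i ∈ I) {r : ℕ}
    (hr : I ^ (r + 1) = Ideal.span (Set.range x) * I ^ r) {N : AddSubmonoid (reesAlgebra I)}
    (hN : ∀ P, ∀ f ∈ N, reesMap I x hx P * f ∈ N)
    (h : ∀ n ≤ r, ∀ b ∈ I ^ n, ∃ f ∈ N, (f : Polynomial R) = Polynomial.monomial n b) (n : ℕ) :
    ∀ b ∈ I ^ n, ∃ f ∈ N, (f : Polynomial R) = Polynomial.monomial n b := by
  have hstep : ∀ n, (∀ b ∈ I ^ n, ∃ f ∈ N, (f : Polynomial R) = Polynomial.monomial n b) →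
      ∀ b ∈ Ideal.span (Set.range x) * I ^ n,
        ∃ f ∈ N, (f : Polynomial R) = Polynomial.monomial (n + 1) b := by
    intro n ih b hb
    refine Submodule.mul_induction_on hb (fun u hu v hv => ?_) (fun u v hu hv => ?_)
    · obtain ⟨w, rfl⟩ := Ideal.mem_span_range_iff_exists_fun.1 hu
      let P : MvPolynomial (Fin c) R := ∑ i, C (w i) * X i
      have hP : P.IsHomogeneous 1 := IsHomogeneous.sum _ _ _ fun i _ => by
        simpa using (isHomogeneous_C _ (w i)).mul (isHomogeneous_X R i)
      obtain ⟨g, hg, hgv⟩ := ih v hv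
      refine ⟨_, hN P g hg, ?_⟩
      rw [MulMemClass.coe_mul, hgv, coe_reesMap_of_isHomogeneous hx hP,
        Polynomial.monomial_mul_monomial, add_comm]
      simp [P]
    · obtain ⟨f, hf, hfu⟩ := hu
      obtain ⟨g, hg, hgv⟩ := hv
      exact ⟨f + g, N.add_mem hf hg, by rw [AddMemClass.coe_add, hfu, hgv, map_add]⟩
  rcases le_or_gt n r with hn | hn
  · exact h n hn
  obtain ⟨k, rfl⟩ := Nat.exists_eq_add_of_lt hn
  clear hn
  have hI : ∀ k, I ^ (r + k + 1) = Ideal.span (Set.range x) * I ^ (r + k) := fun k => by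
    rw [add_assoc, IsReduction.pow_le hr, IsReduction.pow_le hr, pow_succ', mul_assoc]
  induction k with
  | zero => exact hI 0 ▸ hstep r (h r le_rfl)
  | succ k ih => exact hI (k + 1) ▸ hstep _ ih

theorem reesMap_isIntegral [IsNoetherianRing R] (hx : ∀ i, x i ∈ I) {r : ℕ}
    (hr : I ^ (r + 1) = Ideal.span (Set.range x) * I ^ r) :
    (reesMap I x hx).toRingHom.IsIntegral := by
  classical
  refine RingHom.Finite.to_isIntegral ?_
  let _ : Algebra (MvPolynomial (Fin c) R) (reesAlgebra I) := (reesMap I x hx).toRingHom.toAlgebra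
  change Module.Finite _ _
  have hgen : ∀ i : ℕ, ∃ T : Finset R, Ideal.span (T : Set R) = I ^ i := fun i =>
    IsNoetherian.noetherian (I ^ i)
  choose T hT using hgen
  let S : Set (reesAlgebra I) := ⋃ i ∈ Finset.range (r + 1),
    Set.range fun b : T i => reesMonomial I i b.1 (hT i ▸ Ideal.subset_span b.2)
  have hS : S.Finite := Set.Finite.biUnion (Finset.finite_toSet _) fun i _ => Set.finite_range _
  refine ⟨⟨hS.toFinset, ?_⟩⟩
  rw [hS.coe_toFinset, eq_top_iff]
  set N := Submodule.span (MvPolynomial (Fin c) R) S with hN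
  have hNmul : ∀ P, ∀ f ∈ N, reesMap I x hx P * f ∈ N := fun P f hf => N.smul_mem P hf
  have key := exists_coe_eq_monomial hx hr (N := N.toAddSubmonoid) hNmul ?_
  · rintro f -
    have hf : ∀ i, ∃ g ∈ N, (g : Polynomial R) =
        Polynomial.monomial i ((f : Polynomial R).coeff i) := fun i => key i _ (f.2 i)
    choose g hgN hg using hf
    have : f = ∑ i ∈ (f : Polynomial R).support, g i := by
      refine Subtype.ext ?_
      rw [AddSubmonoidClass.coe_finsetSum]
      simp_rw [hg]
      exact (Polynomial.sum_monomial_eq _).symm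
    rw [this]
    exact N.sum_mem fun i _ => hgN i
  · intro n hn b hb
    rw [← hT n] at hb
    induction hb using Submodule.span_induction with
    | mem b hb =>
      exact ⟨reesMonomial I n b (hT n ▸ Ideal.subset_span hb), Submodule.subset_span
        (Set.mem_biUnion (Finset.mem_coe.2 (Finset.mem_range.2 (Nat.lt_succ_of_le hn)))
          ⟨⟨b, hb⟩, rfl⟩), rfl⟩
    | zero => exact ⟨0, N.zero_mem, by simp⟩
    | add u v _ _ hu hv =>
      obtain ⟨f, hf, hfu⟩ := hu
      obtain ⟨g, hg, hgv⟩ := hv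
      exact ⟨f + g, N.add_mem hf hg, by rw [AddMemClass.coe_add, hfu, hgv, map_add]⟩
    | smul a u _ hu =>
      obtain ⟨f, hf, hfu⟩ := hu
      refine ⟨_, hNmul (C a) f hf, ?_⟩
      rw [MulMemClass.coe_mul, hfu, coe_reesMap_of_isHomogeneous hx (isHomogeneous_C _ a),
        Polynomial.monomial_mul_monomial, zero_add, eval_C, smul_eq_mul]

variable [IsLocalRing R]

theorem ker_reesMap (hx : ∀ i, x i ∈ I) (hind : AnalyticallyIndependent I x) :
    RingHom.ker ((Ideal.Quotient.mk ((maximalIdeal R).map (algebraMap R (reesAlgebra I)))).comp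
      (reesMap I x hx).toRingHom) =
        RingHom.ker (MvPolynomial.map (residue R) : MvPolynomial (Fin c) R →+* _) := by
  ext P
  rw [RingHom.mem_ker, RingHom.mem_ker, RingHom.comp_apply, Ideal.Quotient.eq_zero_iff_mem]
  constructor
  · intro h
    rw [← sum_homogeneousComponent P, map_sum]
    refine Finset.sum_eq_zero fun e _ => ?_
    refine hind e _ (homogeneousComponent_isHomogeneous e P) ?_
    rw [← coeff_reesMap hx]
    exact coeff_mem_of_mem_map _ h e
  · intro h
    have hP : P ∈ (maximalIdeal R).map C := by
      rw [mem_map_C_iff]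
      intro m
      rw [← residue_eq_zero_iff, ← coeff_map, h, coeff_zero]
    have hC : (reesMap I x hx).toRingHom.comp C = algebraMap R (reesAlgebra I) :=
      RingHom.ext fun a => (reesMap I x hx).commutes a
    have h2 := Ideal.mem_map_of_mem (reesMap I x hx).toRingHom hP
    rwa [Ideal.map_map, hC] at h2

/-- The reduction property makes the fiber ring integral over the image of `R[X]`, and analytic
independence says that this image is k[X₁, …, X_c], of dimension `c`. -/
theorem analyticSpread_eq_card [IsNoetherianRing R]
    (hx : IsReduction (Ideal.span (Set.range x)) I) (hind : AnalyticallyIndependent I x) :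
    analyticSpread I = c := by
  have hxI : ∀ i, x i ∈ I := fun i => hx.1 (Ideal.subset_span ⟨i, rfl⟩)
  obtain ⟨-, r, hr⟩ := hx
  have hsurj : Function.Surjective
      (MvPolynomial.map (residue R) : MvPolynomial (Fin c) R →+* _) :=
    MvPolynomial.map_surjective _ residue_surjective
  rw [analyticSpread, ringKrullDim_quotient_eq hsurj (reesMap_isIntegral hxI hr)
    (ker_reesMap hxI hind)]
  rw [MvPolynomial.ringKrullDim_of_isNoetherianRing, ringKrullDim_eq_zero_of_field]
  simp

theorem independentReductionsHaveCard_of_analyticSpread [IsNoetherianRing R] {d : ℕ}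
    (h : analyticSpread I = d) : IndependentReductionsHaveCard I d := by
  intro c x hx hind
  have := (analyticSpread_eq_card hx hind).symm.trans h
  exact_mod_cast this

end FiberRing
end GenRed

namespace GenRed
open MvPolynomial

/-! ### Length estimates from multiplication maps -/

section MulMap

variable {R : Type*} [CommRing R]

theorem quotLength_le_of_mul_le_of_le_sup {A A' B B' : Ideal R} (a : R)
    (hA : Ideal.span {a} * A ≤ A') (hB : Ideal.span {a} * B ≤ B')
    (h : A' ≤ B' ⊔ Ideal.span {a} * A) : quotLength A' B' ≤ quotLength A B := by
  let f : A →ₗ[R] A' := (a • A.subtype).codRestrict A' fun x =>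
    hA (Ideal.mul_mem_mul (Ideal.mem_span_singleton_self a) x.2)
  have hf : Submodule.submoduleOf B A ≤ (Submodule.submoduleOf B' A').comap f := fun x hx =>
    hB (Ideal.mul_mem_mul (Ideal.mem_span_singleton_self a) hx)
  refine Module.length_le_of_surjective (Submodule.mapQ _ _ f hf) fun y => ?_
  obtain ⟨y, rfl⟩ := Submodule.Quotient.mk_surjective _ y
  obtain ⟨b, hb, z, hz, hy⟩ := Submodule.mem_sup.1 (h y.2)
  obtain ⟨x, hx, rfl⟩ := Ideal.mem_span_singleton_mul.1 hz
  refine ⟨Submodule.Quotient.mk ⟨x, hx⟩, ?_⟩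
  rw [Submodule.mapQ_apply, Submodule.Quotient.eq]
  change a * x - y ∈ B'
  rw [← hy, sub_add_cancel_right]
  exact neg_mem hb

theorem quotLength_le_of_mul_mem {A A' B B' : Ideal R} (a : R)
    (hA : Ideal.span {a} * A ≤ A') (hB : Ideal.span {a} * B ≤ B')
    (h : ∀ x ∈ A, a * x ∈ B' → x ∈ B) : quotLength A B ≤ quotLength A' B' := by
  let f : A →ₗ[R] A' := (a • A.subtype).codRestrict A' fun x =>
    hA (Ideal.mul_mem_mul (Ideal.mem_span_singleton_self a) x.2)
  have hf : Submodule.submoduleOf B A ≤ (Submodule.submoduleOf B' A').comap f := fun x hx =>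
    hB (Ideal.mul_mem_mul (Ideal.mem_span_singleton_self a) hx)
  refine Module.length_le_of_injective (Submodule.mapQ _ _ f hf) ?_
  rw [← LinearMap.ker_eq_bot, LinearMap.ker_eq_bot']
  intro x hx
  obtain ⟨x, rfl⟩ := Submodule.Quotient.mk_surjective _ x
  rw [Submodule.mapQ_apply, Submodule.Quotient.mk_eq_zero] at hx
  rw [Submodule.Quotient.mk_eq_zero]
  exact h x.1 x.2 hx

theorem quotLength_top_sup_span_mul_le (K : Ideal R) (a b : R) :
    quotLength ⊤ (K ⊔ Ideal.span {a * b}) ≤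
      quotLength ⊤ (K ⊔ Ideal.span {b}) + quotLength ⊤ (K ⊔ Ideal.span {a}) := by
  have hab : Ideal.span {a * b} = Ideal.span {a} * Ideal.span {b} :=
    (Ideal.span_singleton_mul_span_singleton a b).symm
  rw [quotLength_add (B := K ⊔ Ideal.span {a}) (sup_le_sup_left (hab ▸ Ideal.mul_le_left) _) le_top]
  refine add_le_add_left (quotLength_le_of_mul_le_of_le_sup a ?_ ?_ ?_) _
  · exact Ideal.mul_le_left.trans le_sup_right
  · rw [Ideal.mul_sup, hab]
    exact sup_le_sup_right Ideal.mul_le_right _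
  · rw [Ideal.mul_top]
    exact sup_le (le_sup_left.trans le_sup_left) le_sup_right

theorem quotLength_top_sup_span_pow_le (K : Ideal R) (a : R) (n : ℕ) :
    quotLength ⊤ (K ⊔ Ideal.span {a ^ n}) ≤ n * quotLength ⊤ (K ⊔ Ideal.span {a}) := by
  induction n with
  | zero => simp [quotLength_eq_zero_iff]
  | succ n ih =>
    rw [pow_succ]
    refine (quotLength_top_sup_span_mul_le K (a ^ n) a).trans ?_
    rw [Nat.cast_succ, add_mul, one_mul, add_comm]
    exact add_le_add_left ih _

theorem quotLength_top_sup_span_image_pow_le (K : Ideal R) (n : ℕ) (s : Finset R) :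
    quotLength ⊤ (K ⊔ Ideal.span ((· ^ n) '' (s : Set R))) ≤
      n ^ s.card * quotLength ⊤ (K ⊔ Ideal.span (s : Set R)) := by
  classical
  induction s using Finset.induction_on generalizing K with
  | empty => simp
  | insert a s ha ih =>
    rw [Finset.coe_insert, Set.image_insert_eq, Ideal.span_insert, Ideal.span_insert, ← sup_assoc,
      ← sup_assoc, Finset.card_insert_of_notMem ha, pow_succ, mul_assoc]
    refine (ih _).trans (mul_le_mul_right ?_ _)
    have h := quotLength_top_sup_span_pow_le (K ⊔ Ideal.span (s : Set R)) a n
    rwa [sup_right_comm, sup_right_comm K (Ideal.span (s : Set R))] at h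

/-- Adjoining the `v i` to `B` one at a time gives a strict chain, because a failure of strictness
is a relation with a unit coefficient. -/
theorem card_le_quotLength {ι : Type*} [IsLocalRing R] {A B : Ideal R} (hBA : B ≤ A) (v : ι → R)
    (s : Finset ι) (hA : ∀ i ∈ s, v i ∈ A)
    (h : ∀ w : ι → R, ∑ i ∈ s, w i * v i ∈ B → ∀ i ∈ s, w i ∈ maximalIdeal R) :
    (s.card : ℕ∞) ≤ quotLength A B := by
  classical
  induction s using Finset.induction_on generalizing B with
  | empty => simp
  | insert a s ha ih =>
    have hle : B ≤ B ⊔ Ideal.span {v a} := le_sup_left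
    have hle' : B ⊔ Ideal.span {v a} ≤ A := sup_le hBA
      ((Ideal.span_singleton_le_iff_mem _).2 (hA a (Finset.mem_insert_self a s)))
    rw [quotLength_add hle hle', Finset.card_insert_of_notMem ha, Nat.cast_succ, add_comm]
    refine add_le_add (Order.one_le_iff_pos.2 (pos_iff_ne_zero.2 fun h0 => ?_))
      (ih hle' (fun i hi => hA i (Finset.mem_insert_of_mem hi)) fun w hw => ?_)
    · rw [quotLength_eq_zero_iff] at h0
      have hva : v a ∈ B := h0 (Ideal.mem_sup_right (Ideal.mem_span_singleton_self _))
      have := h (Pi.single a 1) (by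
        rw [Finset.sum_insert ha, Finset.sum_eq_zero, add_zero, Pi.single_eq_same, one_mul]
        · exact hva
        · intro i hi
          rw [Pi.single_eq_of_ne (ne_of_mem_of_not_mem hi ha), zero_mul]) a (Finset.mem_insert_self a s)
      rw [Pi.single_eq_same] at this
      exact (Ideal.ne_top_iff_one _).1 (maximalIdeal.isMaximal R).ne_top this
    · obtain ⟨b, hb, z, hz, hbz⟩ := Submodule.mem_sup.1 hw
      obtain ⟨u, rfl⟩ := Ideal.mem_span_singleton'.1 hz
      have h1 := h (Function.update w a (-u)) (by
        rw [Finset.sum_insert ha, Function.update_self,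
          Finset.sum_congr rfl (g := fun i => w i * v i), ← hbz]
        · convert hb using 1; ring
        · intro i hi
          rw [Function.update_of_ne (ne_of_mem_of_not_mem hi ha)])
      intro i hi
      have := h1 i (Finset.mem_insert_of_mem hi)
      rwa [Function.update_of_ne (ne_of_mem_of_not_mem hi ha)] at this

end MulMap

/-! ### Counting monomials for an ideal primary to the maximal ideal -/

section Count

variable {R : Type*} [CommRing R] [IsLocalRing R] {I : Ideal R} {c : ℕ} {x : Fin c → R}

/-- The monomials of degree M count toward the layer I^M/I^(M+1): as I^(M+1) ⊆ 𝔪I^M, analytic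
independence forces the coefficients of any relation there into 𝔪. -/
theorem AnalyticallyIndependent.card_le (hx : AnalyticallyIndependent I x) (hxI : ∀ i, x i ∈ I)
    (hI : I ≤ maximalIdeal R) (s : Finset (Fin c →₀ ℕ)) (M : ℕ) (hs : ∀ m ∈ s, m.degree < M) :
    (s.card : ℕ∞) ≤ quotLength ⊤ (I ^ M) := by
  classical
  induction M generalizing s with
  | zero =>
    have : s = ∅ := Finset.eq_empty_of_forall_notMem fun m hm => by simpa using hs m hm
    simp [this]
  | succ M ih =>
    rw [quotLength_add (Ideal.pow_le_pow_right M.le_succ) le_top,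
      ← Finset.card_filter_add_card_filter_not (s := s) (fun m => m.degree = M), Nat.cast_add]
    refine add_le_add ?_ (ih _ fun m hm => ?_)
    · refine card_le_quotLength (Ideal.pow_le_pow_right M.le_succ)
        (fun m : Fin c →₀ ℕ => eval x (monomial m 1)) _ ?_ ?_
      · intro m hm
        have hm' : ∑ i ∈ m.support, m i = M := (Finset.mem_filter.1 hm).2
        rw [eval_monomial, one_mul, ← hm', Finsupp.prod, ← Finset.prod_pow_eq_pow_sum]
        exact Ideal.prod_mem_prod fun i _ => Ideal.pow_mem_pow (hxI i) _
      · intro w hw m hm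
        set t := s.filter fun m => m.degree = M with ht
        let G : MvPolynomial (Fin c) R := ∑ m ∈ t, monomial m (w m)
        have hG : G.IsHomogeneous M := IsHomogeneous.sum _ _ _ fun m hm =>
          isHomogeneous_monomial _ (Finset.mem_filter.1 hm).2
        have h0 := hx M G hG (by
          have : eval x G = ∑ m ∈ t, w m * eval x (monomial m 1) := by
            simp [G, eval_monomial]
          rw [this]
          refine (Ideal.mul_mono_left hI) ?_
          rwa [← pow_succ'])
        have h1 := congrArg (coeff m) h0
        rw [coeff_map, coeff_zero, residue_eq_zero_iff] at h1
        simpa [G, coeff_sum, coeff_monomial, hm] using h1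
    · rw [Finset.mem_filter] at hm
      have := hs m hm.1
      omega

/-- The monomials counted have all exponents below `q`. For `c = 0` the constant monomial would not
have degree below `c * q`. -/
theorem AnalyticallyIndependent.pow_le_quotLength (hx : AnalyticallyIndependent I x)
    (hxI : ∀ i, x i ∈ I) (hI : I ≤ maximalIdeal R) (q : ℕ) (hc : 1 ≤ c) :
    ((q ^ c : ℕ) : ℕ∞) ≤ quotLength ⊤ (I ^ (c * q)) := by
  classical
  have := hx.card_le hxI hI ((Fintype.piFinset fun _ : Fin c => Finset.range q).map
    (Finsupp.equivFunOnFinite.symm.toEmbedding)) (c * q) ?_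
  · simpa using this
  · intro m hm
    obtain ⟨f, hf, rfl⟩ := Finset.mem_map.1 hm
    rw [Fintype.mem_piFinset] at hf
    rw [Finsupp.degree_eq_sum]
    have : Nonempty (Fin c) := ⟨⟨0, hc⟩⟩
    calc _ < ∑ _i : Fin c, q := Finset.sum_lt_sum_of_nonempty Finset.univ_nonempty
            fun i _ => by simpa using hf i
      _ = c * q := by simp

variable [IsNoetherianRing R] {d : ℕ}

theorem exists_pow_le_of_mem_minimalPrimes {K : Ideal R} (h : maximalIdeal R ∈ K.minimalPrimes) :
    ∃ n, maximalIdeal R ^ n ≤ K := by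
  refine Ideal.exists_pow_le_of_le_radical_of_fg (fun y hy => ?_) (IsNoetherian.noetherian _)
  rw [Ideal.radical_eq_sInf, Submodule.mem_sInf]
  rintro P ⟨hKP, hP⟩
  exact (h.2 ⟨hP, hKP⟩ (le_maximalIdeal hP.ne_top)) hy

/-- For a system of parameters `s`, the powers y^(an) lie in Iⁿ, and raising `d` parameters to a
power multiplies the colength by at most the d-th power of the exponent. -/
theorem quotLength_pow_le {a : ℕ} (ha : maximalIdeal R ^ a ≤ I)
    (hd : ringKrullDim R = d) : ∃ L : ℕ, ∀ n, quotLength ⊤ (I ^ n) ≤ ((n ^ d * L : ℕ) : ℕ∞) := by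
  classical
  obtain ⟨s, hs, hcard⟩ := (maximalIdeal R).exists_finset_card_eq_height_of_isNoetherianRing
  obtain ⟨b, hb⟩ := exists_pow_le_of_mem_minimalPrimes hs
  have hsd : s.card = d := by
    rw [← maximalIdeal_height_eq_ringKrullDim, ← hcard] at hd
    exact_mod_cast hd
  have hfin : quotLength ⊤ (Ideal.span (s : Set R)) ≠ ⊤ :=
    quotLength_ne_top_of_pow le_top (Ideal.mul_le_left.trans hb)
  obtain ⟨L, hL⟩ := ENat.ne_top_iff_exists.1 hfin
  refine ⟨a ^ d * L, fun n => ?_⟩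
  have h1 := quotLength_top_sup_span_image_pow_le ⊥ (a * n) s
  rw [bot_sup_eq, bot_sup_eq, ← hL, hsd] at h1
  refine (quotLength_anti_right ?_ le_top).trans (h1.trans (le_of_eq ?_))
  · rw [Ideal.span_le]
    rintro _ ⟨y, hy, rfl⟩
    have hym : y ∈ maximalIdeal R := hs.1.2 (Ideal.subset_span hy)
    change y ^ (a * n) ∈ I ^ n
    rw [pow_mul]
    exact Ideal.pow_mem_pow (ha (Ideal.pow_mem_pow hym a)) n
  · push_cast
    rw [mul_pow]
    ring

/-- Monomial counting gives growth of order at least `c` against polynomial growth of order `d`, so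
c ≤ d; conversely a reduction is 𝔪-primary, so Krull's height theorem gives d ≤ c. -/
theorem independentReductionsHaveCard_of_radical (hI : I.radical = maximalIdeal R)
    (hd : ringKrullDim R = d) : IndependentReductionsHaveCard I d := by
  intro c x hx hind
  have hxI : ∀ i, x i ∈ I := fun i => hx.1 (Ideal.subset_span ⟨i, rfl⟩)
  have hIm : I ≤ maximalIdeal R := hI ▸ Ideal.le_radical
  obtain ⟨a, ha⟩ := I.exists_radical_pow_le_of_fg (IsNoetherian.noetherian _)
  rw [hI] at ha
  refine le_antisymm ?_ ?_
  · by_contra! hlt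
    obtain ⟨L, hL⟩ := quotLength_pow_le ha hd
    -- If d < c, then q^(d+1) ≤ q^c ≤ (cq)^d L gives q ≤ c^d L, which this `q` just violates.
    set q := c ^ d * L + 1 with hq
    have h1 := (hind.pow_le_quotLength hxI hIm q (by omega)).trans (hL _)
    have h2 : q ^ c ≤ (c * q) ^ d * L := by exact_mod_cast h1
    have h3 : q ^ (d + 1) ≤ q ^ c := Nat.pow_le_pow_right (by omega) hlt
    have h4 : q ^ d * q ≤ q ^ d * (c ^ d * L) := by
      calc q ^ d * q = q ^ (d + 1) := (pow_succ _ _).symm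
        _ ≤ _ := h3.trans h2
        _ = _ := by rw [mul_pow]; ring
    have h5 := Nat.le_of_mul_le_mul_left h4 (Nat.pow_pos (by omega))
    omega
  · obtain ⟨-, r, hr⟩ := hx
    have hmin : maximalIdeal R ∈ (Ideal.span (Set.range x)).minimalPrimes := by
      refine ⟨⟨inferInstance, Ideal.span_le.2 ?_⟩, ?_⟩
      · rintro _ ⟨i, rfl⟩
        exact hIm (hxI i)
      · rintro P ⟨hP, hxP⟩ -
        refine hI ▸ hP.radical_le_iff.2 (Ideal.IsPrime.le_of_pow_le (n := r + 1) ?_)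
        rw [hr]
        exact Ideal.mul_le_left.trans hxP
    have h1 := Ideal.height_le_card_of_mem_minimalPrimes_span (Set.finite_range x) hmin
    have h2 : (Set.range x).ncard ≤ c := by
      rw [← Set.image_univ]
      refine (Set.ncard_image_le Set.finite_univ).trans ?_
      simp [Set.ncard_univ]
    have h3 : (d : WithBot ℕ∞) ≤ (((c : ℕ) : ℕ∞) : WithBot ℕ∞) := by
      rw [← hd, ← maximalIdeal_height_eq_ringKrullDim]
      exact WithBot.coe_le_coe.2 (h1.trans (by exact_mod_cast h2))
    exact_mod_cast h3

end Count
end GenRed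

namespace GenRed

/-! ### Regular sequences and depth in Cohen-Macaulay rings -/

section RegularModulo

variable {R : Type*} [CommRing R]

/-- `x` is a nonzerodivisor modulo the ideal `K`. -/
def RegularModulo (K : Ideal R) (x : R) : Prop :=
  ∀ a, x * a ∈ K → a ∈ K

theorem RegularModulo.swap {K : Ideal R} {x y : R} (hx : RegularModulo K x)
    (hxy : RegularModulo (K ⊔ Ideal.span {x}) y) : RegularModulo (K ⊔ Ideal.span {y}) x := by
  intro a ha
  obtain ⟨k, hk, w, hw, hkw⟩ := Submodule.mem_sup.1 ha
  obtain ⟨b, rfl⟩ := Ideal.mem_span_singleton'.1 hw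
  have hb : y * b ∈ K ⊔ Ideal.span {x} := by
    have : y * b = -k + a * x := by linear_combination hkw
    rw [this]
    exact Submodule.add_mem_sup (neg_mem hk) (Ideal.mem_span_singleton'.2 ⟨a, rfl⟩)
  obtain ⟨k', hk', w', hw', hkw'⟩ := Submodule.mem_sup.1 (hxy b hb)
  obtain ⟨c, rfl⟩ := Ideal.mem_span_singleton'.1 hw'
  have hac : a - c * y ∈ K := hx _ (by
    have : x * (a - c * y) = k + y * k' := by linear_combination -hkw - y * hkw'
    rw [this]
    exact K.add_mem hk (K.mul_mem_left _ hk'))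
  rw [← sub_add_cancel a (c * y)]
  exact Submodule.add_mem_sup hac (Ideal.mem_span_singleton'.2 ⟨c, rfl⟩)

theorem exists_prime_of_notMem [IsNoetherianRing R] {K : Ideal R} {a : R} (ha : a ∉ K) :
    ∃ p ∈ associatedPrimes R (R ⧸ K), ∀ r, r * a ∈ K → r ∈ p := by
  obtain ⟨p, hp, hap⟩ := exists_le_isAssociatedPrime_of_isNoetherianRing R
    (Ideal.Quotient.mk K a) (by rwa [ne_eq, Ideal.Quotient.eq_zero_iff_mem])
  refine ⟨p, hp, fun r hr => hap ?_⟩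
  rw [Submodule.mem_colon_singleton, Submodule.mem_bot]
  exact Ideal.Quotient.eq_zero_iff_mem.2 hr

theorem exists_mem_iff_of_mem_associatedPrimes [IsNoetherianRing R] {K p : Ideal R}
    (hp : p ∈ associatedPrimes R (R ⧸ K)) : p.IsPrime ∧ ∃ a, ∀ r, r ∈ p ↔ r * a ∈ K := by
  obtain ⟨hp, a, ha⟩ := isAssociatedPrime_iff.1 hp
  obtain ⟨a, rfl⟩ := Ideal.Quotient.mk_surjective a
  refine ⟨hp, a, fun r => ?_⟩
  rw [ha, Submodule.mem_colon_singleton, Submodule.mem_bot]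
  exact Ideal.Quotient.eq_zero_iff_mem

theorem exists_mem_of_not_regularModulo [IsNoetherianRing R] {K : Ideal R} {x : R}
    (h : ¬ RegularModulo K x) : ∃ p ∈ associatedPrimes R (R ⧸ K), x ∈ p := by
  rw [RegularModulo] at h
  push Not at h
  obtain ⟨a, hxa, ha⟩ := h
  obtain ⟨p, hp, hap⟩ := exists_prime_of_notMem ha
  exact ⟨p, hp, hap x hxa⟩

variable [IsLocalRing R]

/-- The quotient by `K` has no nonzero element killed by the maximal ideal. -/
def SocleFree (K : Ideal R) : Prop :=
  ∀ a, (∀ u ∈ maximalIdeal R, u * a ∈ K) → a ∈ K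

theorem RegularModulo.socleFree {K : Ideal R} {x : R} (h : RegularModulo K x)
    (hx : x ∈ maximalIdeal R) : SocleFree K :=
  fun a ha => h a (ha x hx)

/-- For x, y in 𝔪 regular modulo `K`, the socles of R/(K + (x)) and R/(K + (y)) are both Ext¹(k,
R/K). The transfer is explicit: xa ≡ by modulo `K` sends a socle class of `a` to one of `b`. -/
theorem SocleFree.exchange {K : Ideal R} {x y : R} (hx : RegularModulo K x)
    (hy : RegularModulo K y) (hxm : x ∈ maximalIdeal R) (h : SocleFree (K ⊔ Ideal.span {x})) :
    SocleFree (K ⊔ Ideal.span {y}) := by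
  intro a ha
  obtain ⟨k, hk, w, hw, hkw⟩ := Submodule.mem_sup.1 (ha x hxm)
  obtain ⟨b, rfl⟩ := Ideal.mem_span_singleton'.1 hw
  have hb : b ∈ K ⊔ Ideal.span {x} := by
    refine h b fun u hu => ?_
    obtain ⟨l, hl, w, hw, hlw⟩ := Submodule.mem_sup.1 (ha u hu)
    obtain ⟨c, rfl⟩ := Ideal.mem_span_singleton'.1 hw
    have : u * b - c * x ∈ K := hy _ (by
      have : y * (u * b - c * x) = x * l - u * k := by linear_combination u * hkw - x * hlw
      rw [this]
      exact K.sub_mem (K.mul_mem_left _ hl) (K.mul_mem_left _ hk))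
    rw [← sub_add_cancel (u * b) (c * x)]
    exact Submodule.add_mem_sup this (Ideal.mem_span_singleton'.2 ⟨c, rfl⟩)
  obtain ⟨l, hl, w, hw, hlw⟩ := Submodule.mem_sup.1 hb
  obtain ⟨c, rfl⟩ := Ideal.mem_span_singleton'.1 hw
  have : a - c * y ∈ K := hx _ (by
    have : x * (a - c * y) = k + y * l := by linear_combination -hkw - y * hlw
    rw [this]
    exact K.add_mem hk (K.mul_mem_left _ hl))
  rw [← sub_add_cancel a (c * y)]
  exact Submodule.add_mem_sup this (Ideal.mem_span_singleton'.2 ⟨c, rfl⟩)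

theorem exists_forall_regularModulo [IsNoetherianRing R] [Infinite (ResidueField R)]
    (S : Finset (Ideal R)) (hS : ∀ K ∈ S, SocleFree K) :
    ∃ z ∈ maximalIdeal R, ∀ K ∈ S, RegularModulo K z := by
  classical
  obtain ⟨z, hz, h⟩ := exists_mem_forall_notMem
    (S.biUnion fun K => (associatedPrimes.finite R (R ⧸ K)).toFinset) (maximalIdeal R) id (by
      intro p hp hmp
      obtain ⟨K, hK, hp⟩ := Finset.mem_biUnion.1 hp
      rw [Set.Finite.mem_toFinset] at hp
      obtain ⟨hp, a, ha⟩ := exists_mem_iff_of_mem_associatedPrimes hp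
      have haK := hS K hK a fun u hu => (ha u).1 (hmp hu)
      exact hp.ne_top ((Ideal.eq_top_iff_one p).2 ((ha 1).2 (by rwa [one_mul]))))
  refine ⟨z, hz, fun K hK => ?_⟩
  by_contra hcon
  obtain ⟨p, hp, hzp⟩ := exists_mem_of_not_regularModulo hcon
  exact h p (Finset.mem_biUnion.2 ⟨K, hK, (Set.Finite.mem_toFinset _).2 hp⟩) hzp

/-- There is a regular sequence of length `n` modulo `K` in the maximal ideal. -/
def DepthGE : ℕ → Ideal R → Prop
  | 0, _ => True
  | n + 1, K => ∃ x ∈ maximalIdeal R, RegularModulo K x ∧ DepthGE n (K ⊔ Ideal.span {x})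

/-- The given first element `x` is exchanged for `y` through a general `z` regular modulo `K`, K +
(x) and K + (y): by induction the depth passes from K + (x) to K + (x, z), and from there, over K +
(z), to K + (z, y). -/
theorem DepthGE.sup_span [IsNoetherianRing R] [Infinite (ResidueField R)] {n : ℕ} {K : Ideal R}
    (h : DepthGE (n + 1) K) {y : R} (hym : y ∈ maximalIdeal R) (hy : RegularModulo K y) :
    DepthGE n (K ⊔ Ideal.span {y}) := by
  classical
  induction n generalizing K y with
  | zero => trivial
  | succ n ih =>
    obtain ⟨x, hxm, hx, h⟩ := h
    obtain ⟨x', hxm', hx', -⟩ := id h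
    have hsx := hx'.socleFree hxm'
    obtain ⟨z, hzm, hz⟩ := exists_forall_regularModulo
      {K, K ⊔ Ideal.span {x}, K ⊔ Ideal.span {y}} (by
        intro L hL
        rw [Finset.mem_insert, Finset.mem_insert, Finset.mem_singleton] at hL
        rcases hL with rfl | rfl | rfl
        · exact hx.socleFree hxm
        · exact hsx
        · exact hsx.exchange hx hy hxm)
    have hzK := hz K (by simp)
    have hzx := hz (K ⊔ Ideal.span {x}) (by simp)
    have hzy := hz (K ⊔ Ideal.span {y}) (by simp)
    refine ⟨z, hzm, hzy, ?_⟩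
    rw [sup_right_comm]
    refine ih ⟨x, hxm, hx.swap hzx, ?_⟩ hym (hy.swap hzy)
    rw [sup_right_comm]
    exact ih h hzm hzx

/-- Killing a regular `x` moves an associated prime `p` strictly up: some `b` with pb ⊆ K stays
nonzero modulo K + (x), so an associated prime of R/(K + (x)) contains both `p` and `x`, while x ∉
p. -/
theorem DepthGE.le_coheight [IsNoetherianRing R] {n : ℕ} {K : Ideal R} (h : DepthGE n K)
    (p : PrimeSpectrum R) (hp : p.asIdeal ∈ associatedPrimes R (R ⧸ K)) :
    (n : ℕ∞) ≤ Order.coheight p := by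
  induction n generalizing K p with
  | zero => simp
  | succ n ih =>
    obtain ⟨x, hxm, hx, h⟩ := h
    obtain ⟨hpp, a, ha⟩ := exists_mem_iff_of_mem_associatedPrimes hp
    have haK : a ∉ K := fun haK =>
      hpp.ne_top ((Ideal.eq_top_iff_one _).2 ((ha 1).2 (by rwa [one_mul])))
    have hKp : K ≤ p.asIdeal := fun r hr => (ha r).2 (K.mul_mem_right _ hr)
    let L : Ideal R := K.colon p.asIdeal
    have hL : ∀ b, b ∈ L ↔ ∀ r ∈ p.asIdeal, r * b ∈ K := by
      intro b
      rw [Submodule.mem_colon]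
      simp_rw [smul_eq_mul, mul_comm b]
      rfl
    have haL : a ∈ L := (hL a).2 fun r hr => (ha r).1 hr
    -- Otherwise regularity of `x` gives L ⊆ K + 𝔪L, and Nakayama gives L ⊆ K, contrary to `a ∉ K`.
    obtain ⟨b, hbL, hbK⟩ : ∃ b ∈ L, b ∉ K ⊔ Ideal.span {x} := by
      by_contra! hcon
      refine haK (Submodule.le_of_le_smul_of_le_jacobson_bot (I := maximalIdeal R)
        (IsNoetherian.noetherian L) (IsLocalRing.maximalIdeal_le_jacobson _) ?_ haL)
      intro b hb
      obtain ⟨k, hk, w, hw, rfl⟩ := Submodule.mem_sup.1 (hcon b hb)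
      obtain ⟨c, rfl⟩ := Ideal.mem_span_singleton'.1 hw
      refine Submodule.add_mem_sup hk ?_
      rw [mul_comm]
      refine Ideal.mul_mem_mul hxm ((hL c).2 fun r hr => hx _ ?_)
      have h1 := (hL _).1 hb r hr
      have : x * (r * c) = r * (k + c * x) - r * k := by ring
      rw [this]
      exact K.sub_mem h1 (K.mul_mem_left _ hk)
    obtain ⟨q, hq, hbq⟩ := exists_prime_of_notMem hbK
    have hqp := (exists_mem_iff_of_mem_associatedPrimes hq).1
    have hlt : p < ⟨q, hqp⟩ := by
      refine lt_of_le_not_ge (fun r hr => hbq r (Ideal.mem_sup_left ((hL b).1 hbL r hr)))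
        fun hle => haK (hx a ((ha x).1 (hle (hbq x ?_))))
      exact Ideal.mem_sup_right (Ideal.mul_mem_right _ _ (Ideal.mem_span_singleton_self x))
    rw [Nat.cast_succ]
    exact (add_le_add_left (ih h ⟨q, hqp⟩ hq) 1).trans (Order.coheight_add_one_le hlt)

theorem DepthGE.of_list {K : Ideal R} (rs : List R) (hm : ∀ x ∈ rs, x ∈ maximalIdeal R)
    (h : ∀ (i : ℕ) (hi : i < rs.length), RegularModulo (K ⊔ Ideal.ofList (rs.take i)) rs[i]) :
    DepthGE rs.length K := by
  induction rs generalizing K with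
  | nil => trivial
  | cons x rs ih =>
    have h0 : RegularModulo (K ⊔ Ideal.ofList []) x := h 0 (Nat.succ_pos _)
    rw [Ideal.ofList_nil, sup_bot_eq] at h0
    refine ⟨x, hm x (by simp), h0, ih (fun y hy => hm y (by simp [hy])) ?_⟩
    intro i hi
    have := h (i + 1) (by simpa using hi)
    simpa [sup_assoc] using this

theorem IsCohenMacaulayLocal.depthGE {d : ℕ} (h : IsCohenMacaulayLocal R)
    (hd : ringKrullDim R = d) : DepthGE d (⊥ : Ideal R) := by
  obtain ⟨rs, hm, hrs, hlen⟩ := h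
  obtain rfl : d = rs.length := by
    rw [hd] at hlen
    exact_mod_cast hlen
  refine DepthGE.of_list rs hm fun i hi a ha => ?_
  have := hrs.toIsWeaklyRegular.regular_mod_prev i hi
  rw [isSMulRegular_quotient_iff_mem_of_smul_mem] at this
  simpa using this a (by simpa using ha)

theorem coheight_le_card [IsNoetherianRing R] (p : PrimeSpectrum R) (s : Finset R)
    (hs : (s : Set R) ⊆ maximalIdeal R) {c : ℕ}
    (h : maximalIdeal R ^ c ≤ p.asIdeal ⊔ Ideal.span (s : Set R)) :
    Order.coheight p ≤ s.card := by
  classical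
  have hloc : IsLocalRing (R ⧸ p.asIdeal) :=
    IsLocalRing.of_surjective' (Ideal.Quotient.mk p.asIdeal) Ideal.Quotient.mk_surjective
  have hmem : ∀ r, Ideal.Quotient.mk p.asIdeal r ∈ maximalIdeal (R ⧸ p.asIdeal) ↔
      r ∈ maximalIdeal R := by
    intro r
    rw [mem_maximalIdeal, mem_maximalIdeal, mem_nonunits_iff, mem_nonunits_iff, not_iff_not]
    refine ⟨fun hu => ?_, fun hu => hu.map _⟩
    obtain ⟨v, hv⟩ := isUnit_iff_exists_inv.1 hu
    obtain ⟨v, rfl⟩ := Ideal.Quotient.mk_surjective v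
    rw [← map_mul, ← map_one (Ideal.Quotient.mk p.asIdeal), Ideal.Quotient.eq] at hv
    have h1 : r * v - 1 ∈ nonunits R := le_maximalIdeal p.2.ne_top hv
    by_contra hr
    refine (Ideal.ne_top_iff_one _).1 (maximalIdeal.isMaximal R).ne_top ?_
    have h2 := (maximalIdeal R).sub_mem ((maximalIdeal R).mul_mem_right v hr) h1
    rwa [sub_sub_cancel] at h2
  have hmin : maximalIdeal (R ⧸ p.asIdeal) ∈
      (Ideal.span ((s.image (Ideal.Quotient.mk p.asIdeal) : Finset _) : Set _)).minimalPrimes := by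
    refine ⟨⟨inferInstance, Ideal.span_le.2 ?_⟩, ?_⟩
    · rw [Finset.coe_image]
      rintro _ ⟨y, hy, rfl⟩
      exact (hmem y).2 (hs hy)
    · rintro Q ⟨hQ, hsQ⟩ - y hy
      obtain ⟨r, rfl⟩ := Ideal.Quotient.mk_surjective y
      have hle : maximalIdeal R ^ c ≤ Q.comap (Ideal.Quotient.mk p.asIdeal) := by
        refine h.trans (sup_le (fun r hr => ?_) (Ideal.span_le.2 fun r hr => hsQ ?_))
        · rw [Ideal.mem_comap, Ideal.Quotient.eq_zero_iff_mem.2 hr]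
          exact Q.zero_mem
        · exact Ideal.subset_span (Finset.mem_coe.2 (Finset.mem_image_of_mem _ hr))
      exact (hQ.comap (Ideal.Quotient.mk p.asIdeal)).le_of_pow_le hle ((hmem r).1 hy)
  have hdim : ((Order.coheight p : ℕ∞) : WithBot ℕ∞) = ringKrullDim (R ⧸ p.asIdeal) := by
    rw [ringKrullDim_quotient, Order.coheight_eq_krullDim_Ici]
    rfl
  rw [← maximalIdeal_height_eq_ringKrullDim, WithBot.coe_inj] at hdim
  rw [hdim]
  exact (Ideal.height_le_card_of_mem_minimalPrimes_span_finset hmin).trans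
    (by exact_mod_cast Finset.card_image_le)

/-- In a ring of depth at least the number of the elements `x i`, if these generate an ideal primary
to the maximal ideal, then they form a regular sequence in every order. -/
theorem DepthGE.regularModulo [IsNoetherianRing R] [Infinite (ResidueField R)] {ι : Type*}
    [Fintype ι] {x : ι → R} (h : DepthGE (Fintype.card ι) (⊥ : Ideal R))
    (hx : ∀ i, x i ∈ maximalIdeal R) {c : ℕ}
    (hc : maximalIdeal R ^ c ≤ Ideal.span (Set.range x)) (T : Finset ι) (i : ι) (hi : i ∉ T) :
    RegularModulo (Ideal.span (x '' T)) (x i) := by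
  classical
  have key : ∀ (T : Finset ι) (i : ι) (n : ℕ), n + 1 + T.card = Fintype.card ι →
      DepthGE (n + 1) (Ideal.span (x '' T)) → i ∉ T → RegularModulo (Ideal.span (x '' T)) (x i) := by
    intro T i n hn hD hi
    by_contra hcon
    obtain ⟨p, hp, hxp⟩ := exists_mem_of_not_regularModulo hcon
    obtain ⟨hpp, a, ha⟩ := exists_mem_iff_of_mem_associatedPrimes hp
    have h1 := hD.le_coheight ⟨p, hpp⟩ hp
    -- The prime `p` contains `x i` and all `x j` with `j ∈ T`, so the remaining `n` elements
    -- generate an 𝔪-primary ideal modulo `p`, while depth demands dimension at least `n + 1`.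
    have h2 := coheight_le_card ⟨p, hpp⟩ (((insert i T)ᶜ : Finset ι).image x) (by
      rw [Finset.coe_image]
      rintro _ ⟨j, -, rfl⟩
      exact hx j) (hc.trans (Ideal.span_le.2 (by
        rintro _ ⟨j, rfl⟩
        by_cases hj : j ∈ insert i T
        · refine Ideal.mem_sup_left ?_
          rcases Finset.mem_insert.1 hj with rfl | hj
          · exact hxp
          · exact (ha _).2 (Ideal.mul_mem_right _ _ (Ideal.subset_span ⟨j, hj, rfl⟩))
        · refine Ideal.mem_sup_right (Ideal.subset_span ?_)
          exact Finset.mem_coe.2 (Finset.mem_image_of_mem _ (Finset.mem_compl.2 hj)))))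
    have h3 : n + 1 ≤ ((insert i T)ᶜ : Finset ι).card := by
      have : ((n + 1 : ℕ) : ℕ∞) ≤ (((insert i T)ᶜ : Finset ι).card : ℕ∞) :=
        (h1.trans h2).trans (by exact_mod_cast Finset.card_image_le)
      exact_mod_cast this
    rw [Finset.card_compl, Finset.card_insert_of_notMem hi] at h3
    omega
  have hdepth : ∀ (T : Finset ι) (n : ℕ), n + T.card = Fintype.card ι →
      DepthGE n (Ideal.span (x '' T)) := by
    intro T
    induction T using Finset.induction_on with
    | empty =>
      intro n hn
      rw [Finset.card_empty, add_zero] at hn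
      simpa [hn] using h
    | insert i T hi ih =>
      intro n hn
      rw [Finset.card_insert_of_notMem hi] at hn
      have h1 := ih (n + 1) (by omega)
      rw [Finset.coe_insert, Set.image_insert_eq, Ideal.span_insert, sup_comm]
      exact h1.sup_span (hx i) (key T i n (by omega) h1 hi)
  have hlt : T.card < Fintype.card ι := by
    rw [← Finset.card_univ]
    exact Finset.card_lt_card (Finset.ssubset_univ_iff.2 fun h => hi (h ▸ Finset.mem_univ i))
  obtain ⟨n, hn⟩ := Nat.exists_eq_add_of_lt hlt
  exact key T i n (by omega) (hdepth T (n + 1) (by omega)) hi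

end RegularModulo
end GenRed

namespace GenRed

/-! ### Colengths of powers of regular sequences -/

section PowersOfRegularSequences

variable {R : Type*} [CommRing R]

theorem sup_span_pow_succ_le (J : Ideal R) (z : R) (m : ℕ) :
    (J ⊔ Ideal.span {z}) ^ (m + 1) ≤
      J ^ (m + 1) ⊔ Ideal.span {z} * (J ⊔ Ideal.span {z}) ^ m := by
  induction m with
  | zero => simp
  | succ m ih =>
    rw [pow_succ' _ (m + 1)]
    nth_rewrite 1 [Ideal.sup_mul]
    refine sup_le ((Ideal.mul_mono_right ih).trans ?_) le_sup_right
    rw [Ideal.mul_sup, ← pow_succ', mul_left_comm]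
    refine sup_le_sup_left (Ideal.mul_mono_right ?_) _
    rw [pow_succ' _ m]
    exact Ideal.mul_mono_left le_sup_left

theorem RegularModulo.mem_of_mul_mem_pow {J K : Ideal R} {z b : R} {m : ℕ}
    (h : RegularModulo (J ^ (m + 1) ⊔ K) z)
    (hb : z * b ∈ (J ⊔ Ideal.span {z}) ^ (m + 1) ⊔ K) : b ∈ (J ⊔ Ideal.span {z}) ^ m ⊔ K := by
  have h1 : (J ⊔ Ideal.span {z}) ^ (m + 1) ⊔ K ≤
      (J ^ (m + 1) ⊔ K) ⊔ Ideal.span {z} * (J ⊔ Ideal.span {z}) ^ m := by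
    rw [sup_right_comm]
    exact sup_le_sup_right (sup_span_pow_succ_le J z m) _
  obtain ⟨f, hf, w, hw, hfw⟩ := Submodule.mem_sup.1 (h1 hb)
  obtain ⟨e, he, rfl⟩ := Ideal.mem_span_singleton_mul.1 hw
  have h2 : b - e ∈ J ^ (m + 1) ⊔ K := h _ (by
    have : z * (b - e) = f := by linear_combination -hfw
    rwa [this])
  rw [← sub_add_cancel b e]
  refine Ideal.add_mem _ (sup_le_sup_right ?_ K h2) (Ideal.mem_sup_left he)
  exact (Ideal.pow_right_mono le_sup_left _).trans (Ideal.pow_le_pow_right m.le_succ)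

/-- With A = J + (z), multiplication by `z` is an isomorphism from R/(A^m + K) onto (J^(m+1) + (z) +
K)/(A^(m+1) + K). -/
theorem RegularModulo.quotLength_pow_succ {J K : Ideal R} {z : R} {m : ℕ}
    (h : RegularModulo (J ^ (m + 1) ⊔ K) z) :
    quotLength ⊤ ((J ⊔ Ideal.span {z}) ^ (m + 1) ⊔ K) =
      quotLength ⊤ ((J ⊔ Ideal.span {z}) ^ m ⊔ K) +
        quotLength ⊤ (J ^ (m + 1) ⊔ (Ideal.span {z} ⊔ K)) := by
  set A := J ⊔ Ideal.span {z} with hA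
  have hzA : Ideal.span {z} ≤ A := le_sup_right
  have hle : A ^ (m + 1) ⊔ K ≤ J ^ (m + 1) ⊔ (Ideal.span {z} ⊔ K) := by
    rw [← sup_assoc]
    exact sup_le_sup_right ((sup_span_pow_succ_le J z m).trans
      (sup_le_sup_left Ideal.mul_le_left _)) K
  have hmul : Ideal.span {z} * (A ^ m ⊔ K) ≤ A ^ (m + 1) ⊔ K := by
    rw [Ideal.mul_sup, pow_succ']
    exact sup_le_sup (Ideal.mul_mono_left hzA) Ideal.mul_le_right
  have htop : Ideal.span {z} * ⊤ ≤ J ^ (m + 1) ⊔ (Ideal.span {z} ⊔ K) :=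
    Ideal.mul_le_left.trans (le_sup_left.trans le_sup_right)
  rw [quotLength_add hle le_top]
  congr 1
  refine le_antisymm (quotLength_le_of_mul_le_of_le_sup z htop hmul ?_)
    (quotLength_le_of_mul_mem z htop hmul fun b _ hb => h.mem_of_mul_mem_pow hb)
  rw [Ideal.mul_top]
  refine sup_le ?_ (sup_le le_sup_right (le_sup_right.trans le_sup_left))
  exact ((Ideal.pow_right_mono le_sup_left _).trans le_sup_left).trans le_sup_left

variable {ι : Type*} {x : ι → R}

theorem span_image_insert [DecidableEq ι] (x : ι → R) (j : ι) (T : Finset ι) :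
    Ideal.span (x '' (insert j T : Finset ι)) = Ideal.span (x '' T) ⊔ Ideal.span {x j} := by
  rw [Finset.coe_insert, Set.image_insert_eq, Ideal.span_insert, sup_comm]

theorem regularModulo_pow_sup
    (hx : ∀ (T : Finset ι) (i : ι), i ∉ T → RegularModulo (Ideal.span (x '' T)) (x i))
    (T S : Finset ι) (hST : Disjoint S T) (i : ι) (hiS : i ∉ S) (hiT : i ∉ T) (m : ℕ) :
    RegularModulo (Ideal.span (x '' T) ^ m ⊔ Ideal.span (x '' S)) (x i) := by
  classical
  induction T using Finset.induction_on generalizing S i m with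
  | empty =>
    cases m with
    | zero => intro a _; simp
    | succ m => simpa using hx S i hiS
  | insert j T hj ih =>
    rw [Finset.mem_insert, not_or] at hiT
    rw [Finset.disjoint_insert_right] at hST
    induction m with
    | zero => intro a _; simp
    | succ m ihm =>
      intro a ha
      rw [span_image_insert] at ihm ha ⊢
      have hle : (Ideal.span (x '' T) ⊔ Ideal.span {x j}) ^ (m + 1) ⊔ Ideal.span (x '' S) ≤
          Ideal.span (x '' T) ^ (m + 1) ⊔ Ideal.span (x '' (insert j S : Finset ι)) := by
        rw [span_image_insert, ← sup_assoc, sup_right_comm]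
        exact sup_le_sup_right ((sup_span_pow_succ_le _ _ m).trans
          (sup_le_sup_left Ideal.mul_le_left _)) _
      have h1 := ih (insert j S) (Finset.disjoint_insert_left.2 ⟨hj, hST.2⟩) i
        (by rw [Finset.mem_insert, not_or]; exact ⟨hiT.1, hiS⟩) hiT.2 (m + 1) a (hle ha)
      rw [span_image_insert, ← sup_assoc] at h1
      obtain ⟨f, hf, w, hw, rfl⟩ := Submodule.mem_sup.1 h1
      obtain ⟨b, rfl⟩ := Ideal.mem_span_singleton'.1 hw
      have hf' : f ∈ (Ideal.span (x '' T) ⊔ Ideal.span {x j}) ^ (m + 1) ⊔ Ideal.span (x '' S) :=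
        (sup_le_sup_right (Ideal.pow_right_mono le_sup_left _) _ : Ideal.span (x '' T) ^ (m + 1) ⊔
          Ideal.span (x '' S) ≤ _) hf
      refine Ideal.add_mem _ hf' ?_
      -- Cancelling `x j` lowers the power from `m + 1` to `m`, after which the inner induction
      -- cancels `x i`.
      have h2 : x j * (x i * b) ∈
          (Ideal.span (x '' T) ⊔ Ideal.span {x j}) ^ (m + 1) ⊔ Ideal.span (x '' S) := by
        have : x j * (x i * b) = x i * (f + b * x j) - x i * f := by ring
        rw [this]
        exact Ideal.sub_mem _ ha (Ideal.mul_mem_left _ _ hf')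
      have h3 := ihm b ((ih S hST.2 j hST.1 hj (m + 1)).mem_of_mul_mem_pow h2)
      obtain ⟨u, hu, v, hv, rfl⟩ := Submodule.mem_sup.1 h3
      rw [add_mul]
      refine Submodule.add_mem_sup ?_ (Ideal.mul_mem_right _ _ hv)
      rw [pow_succ]
      exact Ideal.mul_mem_mul hu (Ideal.mem_sup_right (Ideal.mem_span_singleton_self _))

/-- The recursion of `RegularModulo.quotLength_pow_succ` is Pascal's rule. The set `S` collects the
elements already divided out. -/
theorem quotLength_top_pow_sup
    (hx : ∀ (T : Finset ι) (i : ι), i ∉ T → RegularModulo (Ideal.span (x '' T)) (x i))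
    (T S : Finset ι) (hST : Disjoint S T) (n : ℕ) :
    quotLength ⊤ (Ideal.span (x '' T) ^ (n + 1) ⊔ Ideal.span (x '' S)) =
      ((n + T.card).choose T.card : ℕ) *
        quotLength ⊤ (Ideal.span (x '' T) ⊔ Ideal.span (x '' S)) := by
  classical
  induction T using Finset.induction_on generalizing S n with
  | empty => simp
  | insert j T hj ih =>
    rw [Finset.disjoint_insert_right] at hST
    have hS : Disjoint (insert j S) T := Finset.disjoint_insert_left.2 ⟨hj, hST.2⟩
    rw [Finset.card_insert_of_notMem hj, span_image_insert]
    induction n with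
    | zero => simp
    | succ n ihn =>
      have hj' := regularModulo_pow_sup hx T S hST.2 j hST.1 hj (n + 1 + 1)
      have ih' := ih (insert j S) hS (n + 1)
      rw [span_image_insert, sup_comm (Ideal.span (x '' (S : Set ι))),
        ← sup_assoc (Ideal.span (x '' T))] at ih'
      rw [hj'.quotLength_pow_succ, ihn, ih', ← add_mul]
      congr 1
      rw [← Nat.cast_add]
      congr 1
      rw [show n + 1 + (T.card + 1) = n + 1 + T.card + 1 by ring, Nat.choose_succ_succ, add_comm]
      congr 2
      ring

theorem quotLength_top_pow [Fintype ι]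
    (hx : ∀ (T : Finset ι) (i : ι), i ∉ T → RegularModulo (Ideal.span (x '' T)) (x i)) (n : ℕ) :
    quotLength ⊤ (Ideal.span (Set.range x) ^ (n + 1)) =
      ((n + Fintype.card ι).choose (Fintype.card ι) : ℕ) *
        quotLength ⊤ (Ideal.span (Set.range x)) := by
  have := quotLength_top_pow_sup hx Finset.univ ∅ (Finset.disjoint_empty_left _) n
  simpa using this

/-- The ratio of the two binomial coefficients tends to 1 as `n` grows, because a shift of `n` by
`r` does not affect the leading term. -/
theorem exists_mul_choose_lt (L r d : ℕ) :
    ∃ n : ℕ, L * (n + r + d).choose d < (L + 1) * (n + d).choose d := by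
  have hstep : ∀ n : ℕ, ((n + 1 + d).choose d : ℝ) =
      (1 + (d : ℝ) / (n + 1)) * (n + d).choose d := by
    intro n
    have h := Nat.choose_mul_succ_eq (n + d) d
    rw [show n + d + 1 - d = n + 1 by omega, show n + d + 1 = n + 1 + d by ring] at h
    have h' : ((n + d).choose d : ℝ) * (n + 1 + d) = (n + 1 + d).choose d * (n + 1) := by
      exact_mod_cast h
    have : (n : ℝ) + 1 ≠ 0 := by positivity
    field_simp
    linarith
  have hle : ∀ n r : ℕ, ((n + r + d).choose d : ℝ) ≤
      (1 + (d : ℝ) / (n + 1)) ^ r * (n + d).choose d := by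
    intro n r
    induction r with
    | zero => simp
    | succ r ih =>
      rw [← add_assoc, hstep, pow_succ', mul_assoc]
      refine mul_le_mul ?_ ih (by positivity) (by positivity)
      push_cast
      gcongr
      linarith [(Nat.cast_nonneg r : (0 : ℝ) ≤ r)]
  have hlim : Filter.Tendsto (fun n : ℕ => (L : ℝ) * (1 + (d : ℝ) / (n + 1)) ^ r) Filter.atTop
      (nhds (L * (1 + 0) ^ r)) := by
    refine Filter.Tendsto.const_mul _ (Filter.Tendsto.pow (Filter.Tendsto.const_add _ ?_) _)
    have := (Filter.tendsto_add_atTop_iff_nat 1).2 (tendsto_const_div_atTop_nhds_zero_nat (d : ℝ))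
    simpa using this
  rw [add_zero, one_pow, mul_one] at hlim
  obtain ⟨n, hn⟩ := (hlim.eventually_lt_const (lt_add_one (L : ℝ))).exists
  refine ⟨n, ?_⟩
  have hpos : (0 : ℝ) < (n + d).choose d := by exact_mod_cast Nat.choose_pos (by omega)
  have : (L : ℝ) * (n + r + d).choose d < (L + 1) * (n + d).choose d := by
    calc (L : ℝ) * (n + r + d).choose d
        ≤ L * ((1 + (d : ℝ) / (n + 1)) ^ r * (n + d).choose d) := by
          gcongr
          exact hle n r
      _ = L * (1 + (d : ℝ) / (n + 1)) ^ r * (n + d).choose d := by ring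
      _ < _ := mul_lt_mul_of_pos_right hn hpos
  exact_mod_cast this

/-- Since (x)^(n+r+1) ⊆ I^(n+r+1) ⊆ (y)^(n+1), the binomial formulas bound the colength of (y) by
that of (x) times a factor tending to 1, and lengths are integers. By symmetry the colengths agree;
their common value is the multiplicity of `I`. -/
theorem quotLength_top_le_of_isReduction {d : ℕ} {I : Ideal R} {x y : Fin d → R}
    (hx : ∀ (T : Finset (Fin d)) i, i ∉ T → RegularModulo (Ideal.span (x '' T)) (x i))
    (hy : ∀ (T : Finset (Fin d)) i, i ∉ T → RegularModulo (Ideal.span (y '' T)) (y i))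
    (hxI : IsReduction (Ideal.span (Set.range x)) I)
    (hyI : IsReduction (Ideal.span (Set.range y)) I) :
    quotLength ⊤ (Ideal.span (Set.range y)) ≤ quotLength ⊤ (Ideal.span (Set.range x)) := by
  by_contra! hlt
  obtain ⟨L, hL⟩ := ENat.ne_top_iff_exists.1 hlt.ne_top
  obtain ⟨r, hr⟩ := hyI.exists_pow_eq
  obtain ⟨n, hn⟩ := exists_mul_choose_lt L r d
  rw [← hL] at hlt
  have h1 : quotLength ⊤ (Ideal.span (Set.range y) ^ (n + 1)) ≤
      quotLength ⊤ (Ideal.span (Set.range x) ^ (n + r + 1)) := by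
    refine quotLength_anti_right ((Ideal.pow_right_mono hxI.1 _).trans ?_) le_top
    rw [show n + r + 1 = r + (n + 1) by ring, hr]
    exact Ideal.mul_le_left
  rw [quotLength_top_pow hx, quotLength_top_pow hy, Fintype.card_fin, ← hL] at h1
  have h2 : ((L + 1 : ℕ) : ℕ∞) ≤ quotLength ⊤ (Ideal.span (Set.range y)) := by
    rw [Nat.cast_succ]
    exact Order.add_one_le_of_lt hlt
  have h3 := (mul_le_mul_right h2 (((n + d).choose d : ℕ) : ℕ∞)).trans h1
  have h4 : (n + d).choose d * (L + 1) ≤ (n + r + d).choose d * L := by exact_mod_cast h3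
  rw [mul_comm, mul_comm _ L] at h4
  omega

end PowersOfRegularSequences
end GenRed

namespace GenRed

/-! ### Finiteness, and comparison of minimal reductions -/

section Main

variable {R : Type*} [CommRing R] {I : Ideal R} {d : ℕ}

theorem pow_le_mul_add {J : Ideal R} (hJ : J ≤ I) {n : ℕ} (hn : 1 ≤ n) :
    J ^ n ≤ J * I ^ (n - 1) + I ^ (n + 1) := by
  obtain ⟨n, rfl⟩ := Nat.exists_eq_add_of_le' hn
  rw [Nat.add_sub_cancel, pow_succ' J]
  exact (Ideal.mul_mono_right (Ideal.pow_right_mono hJ n)).trans le_sup_left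

theorem mul_add_le_pow {J : Ideal R} (hJ : J ≤ I) {n : ℕ} (hn : 1 ≤ n) :
    J * I ^ (n - 1) + I ^ (n + 1) ≤ I ^ n := by
  obtain ⟨n, rfl⟩ := Nat.exists_eq_add_of_le' hn
  rw [Nat.add_sub_cancel]
  refine sup_le ?_ (Ideal.pow_le_pow_right (by omega))
  rw [pow_succ']
  exact Ideal.mul_mono_left hJ

/-- Both sides split through I²/(J ∩ I²) ≅ (J + I²)/J. Stated additively, the identity needs no
finiteness. -/
theorem quotLength_inf_add {J : Ideal R} (hJ : J ≤ I) :
    quotLength (J ⊓ I ^ 2) (J * I) + quotLength ⊤ J =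
      quotLength (I ^ 2) (J * I) + quotLength ⊤ (J ⊔ I ^ 2) := by
  have hle : J * I ≤ J ⊓ I ^ 2 :=
    le_inf Ideal.mul_le_left (by rw [pow_two]; exact Ideal.mul_mono_left hJ)
  rw [quotLength_add hle inf_le_right, quotLength_add (B := J ⊔ I ^ 2) le_sup_left le_top,
    sup_comm J, quotLength_sup, inf_comm J, add_assoc]

variable [IsLocalRing R]

/-- Iterating the hypothesis gives 𝔪^(ck) I ⊆ J + I^(k+1), and I^(r+1) ⊆ J for the reduction
exponent `r`. -/
theorem IsReduction.exists_pow_mul_le {J : Ideal R} (hJ : IsReduction J I) {c : ℕ}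
    (hc : maximalIdeal R ^ c * I ≤ J ⊔ I ^ 2) : ∃ c, maximalIdeal R ^ c * I ≤ J := by
  obtain ⟨hJI, r, hr⟩ := hJ
  have key : ∀ k, maximalIdeal R ^ (c * k) * I ≤ J ⊔ I ^ (k + 1) := by
    intro k
    induction k with
    | zero => simp
    | succ k ih =>
      rw [mul_add, mul_one, add_comm, pow_add, mul_assoc]
      refine (Ideal.mul_mono_right ih).trans ?_
      rw [Ideal.mul_sup, pow_succ' I, ← mul_assoc]
      refine sup_le (Ideal.mul_le_right.trans le_sup_left) ((Ideal.mul_mono_left hc).trans ?_)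
      rw [Ideal.sup_mul, ← pow_add]
      exact sup_le (Ideal.mul_le_left.trans le_sup_left)
        ((Ideal.pow_le_pow_right (by omega)).trans le_sup_right)
  refine ⟨c * r, (key r).trans (sup_le le_rfl ?_)⟩
  rw [hr]
  exact Ideal.mul_le_left

variable [IsNoetherianRing R]

/-- The chain 𝔪^i A + B cannot descend strictly forever when A/B has finite length, and where it
stalls Nakayama applies. -/
theorem exists_pow_mul_le_of_quotLength_ne_top {A B : Ideal R} (hBA : B ≤ A)
    (h : quotLength A B ≠ ⊤) : ∃ c, maximalIdeal R ^ c * A ≤ B := by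
  let f : ℕ → Ideal R := fun i => maximalIdeal R ^ i * A ⊔ B
  have hanti : ∀ i, f (i + 1) ≤ f i := fun i =>
    sup_le_sup_right (Ideal.mul_mono_left (Ideal.pow_le_pow_right i.le_succ)) _
  by_cases hstrict : StrictAnti f
  · refine absurd ?_ h
    have h1 := krullDim_le_quotLength (A := A) (B := B) (fun i : ℕᵒᵈ => f (OrderDual.ofDual i))
      (fun i j hij => hstrict hij) (fun i => le_sup_right) (fun i => sup_le Ideal.mul_le_right hBA)
    rw [Order.krullDim_orderDual, Order.krullDim_nat] at h1
    exact WithBot.coe_eq_coe.1 (top_le_iff.1 h1)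
  · obtain ⟨i, hi⟩ : ∃ i, f i ≤ f (i + 1) := by
      by_contra! hcon
      exact hstrict (strictAnti_nat_of_succ_lt fun i => lt_of_le_not_ge (hanti i) (hcon i))
    refine ⟨i, Submodule.le_of_le_smul_of_le_jacobson_bot (I := maximalIdeal R)
      (IsNoetherian.noetherian _) (IsLocalRing.maximalIdeal_le_jacobson _) ?_⟩
    refine le_sup_left.trans (hi.trans (sup_le ?_ le_sup_left))
    rw [pow_succ', mul_assoc]
    exact le_sup_right

theorem quotLength_pow_ne_top {J : Ideal R} (hJ : J ≤ I) {c : ℕ}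
    (hc : maximalIdeal R ^ c * I ≤ J) (n : ℕ) : quotLength (I ^ n) (J ^ n) ≠ ⊤ := by
  refine quotLength_ne_top_of_pow (c := c * n) (Ideal.pow_right_mono hJ n) ?_
  rw [pow_mul, ← mul_pow]
  exact Ideal.pow_right_mono hc n

theorem IsReduction.quotLength_top_ne_top (hI : I.radical = maximalIdeal R) {J : Ideal R}
    (hJ : IsReduction J I) : quotLength ⊤ J ≠ ⊤ := by
  obtain ⟨a, ha⟩ := I.exists_radical_pow_le_of_fg (IsNoetherian.noetherian _)
  rw [hI] at ha
  obtain ⟨-, r, hr⟩ := hJ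
  refine quotLength_ne_top_of_pow (c := a * (r + 1)) le_top (Ideal.mul_le_left.trans ?_)
  rw [pow_mul]
  refine (Ideal.pow_right_mono ha _).trans ?_
  rw [hr]
  exact Ideal.mul_le_left

variable [Infinite (ResidueField R)]

/-- The elements provided by `G_d` need not generate a reduction, but they bound the generic value
of λ(I/(J + I²)); a general `J` attains that value and is a minimal reduction. -/
theorem SatisfiesG.exists_isMinimalReduction (h : SatisfiesG I d) (hd : ringKrullDim R = d)
    (hI : IndependentReductionsHaveCard I d) :
    ∃ (J : Ideal R) (c : ℕ), IsMinimalReduction J I ∧ maximalIdeal R ^ c * I ≤ J := by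
  obtain ⟨x, c, hxI, hx⟩ := h.exists_pow_mul_le hd
  obtain ⟨s, a, ha'⟩ := Submodule.fg_iff_exists_fin_generating_family.1 (IsNoetherian.noetherian I)
  have ha : Ideal.span (Set.range a) = I := ha'
  have hxa : ∀ i, ∃ c : Fin s → R, ∑ j, c j * a j = x i := fun i =>
    Ideal.mem_span_range_iff_exists_fun.1 (ha ▸ hxI i)
  choose b hb using hxa
  have hbx : combinationIdeal a (fun ij : Fin d × Fin s => b ij.1 ij.2) =
      Ideal.span (Set.range x) := by
    rw [combinationIdeal]
    simp_rw [hb]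
  have hxI' : Ideal.span (Set.range x) ≤ I := Ideal.span_le.2 (by rintro _ ⟨i, rfl⟩; exact hxI i)
  have hI2 : I ^ 2 ≤ I := Ideal.pow_le_self two_ne_zero
  obtain ⟨E, F, hF, hEF⟩ := isSpecializedLength_sup I d s a ha
  obtain ⟨α, hα, hαmin⟩ := ((generically_quotLength_le hF).and
    (hI.generically_isMinimalReduction ha)).exists
  have hle := hα fun ij => b ij.1 ij.2
  rw [← hEF, ← hEF, hbx] at hle
  have hfin := ne_top_of_le_ne_top (quotLength_ne_top_of_pow (sup_le hxI' hI2) hx) hle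
  obtain ⟨c', hc'⟩ := exists_pow_mul_le_of_quotLength_ne_top (sup_le hαmin.1.1 hI2) hfin
  obtain ⟨c'', hc''⟩ := hαmin.1.exists_pow_mul_le hc'
  exact ⟨_, c'', hαmin, hc''⟩

theorem IsCohenMacaulayLocal.regularModulo (hCM : IsCohenMacaulayLocal R)
    (hd : ringKrullDim R = d) (hI : I.radical = maximalIdeal R) {x : Fin d → R}
    (hx : IsReduction (Ideal.span (Set.range x)) I) (T : Finset (Fin d)) (i : Fin d) (hi : i ∉ T) :
    RegularModulo (Ideal.span (x '' T)) (x i) := by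
  obtain ⟨a, ha⟩ := I.exists_radical_pow_le_of_fg (IsNoetherian.noetherian _)
  rw [hI] at ha
  obtain ⟨hxI, r, hr⟩ := hx
  have hD : DepthGE (Fintype.card (Fin d)) (⊥ : Ideal R) := by
    rw [Fintype.card_fin]
    exact hCM.depthGE hd
  refine hD.regularModulo
    (fun i => hI ▸ Ideal.le_radical (hxI (Ideal.subset_span ⟨i, rfl⟩))) (c := a * (r + 1)) ?_ T i hi
  rw [pow_mul]
  refine (Ideal.pow_right_mono ha _).trans ?_
  rw [hr]
  exact Ideal.mul_le_left

theorem IsCohenMacaulayLocal.quotLength_top_le (hCM : IsCohenMacaulayLocal R)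
    (hd : ringKrullDim R = d) (hI : I.radical = maximalIdeal R) {J H : Ideal R}
    (hJ : IsMinimalReduction J I) (hH : IsMinimalReduction H I) :
    quotLength ⊤ H ≤ quotLength ⊤ J := by
  have hcard := independentReductionsHaveCard_of_radical hI hd
  obtain ⟨s, a, ha'⟩ := Submodule.fg_iff_exists_fin_generating_family.1 (IsNoetherian.noetherian I)
  have ha : Ideal.span (Set.range a) = I := ha'
  obtain ⟨α, rfl⟩ := hcard.exists_combinationIdeal ha hJ
  obtain ⟨β, rfl⟩ := hcard.exists_combinationIdeal ha hH
  exact quotLength_top_le_of_isReduction (hCM.regularModulo hd hI hJ.1)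
    (hCM.regularModulo hd hI hH.1) hJ.1 hH.1

end Main
end GenRed

open GenRed in
theorem mainTheorem12 {R : Type*} [CommRing R] [IsLocalRing R] [IsNoetherianRing R]
    [Infinite (IsLocalRing.ResidueField R)] (d : ℕ) (hd : ringKrullDim R = d) (I : Ideal R) :
    (GenRed.analyticSpread I = d → GenRed.SatisfiesG I d → ∀ n : ℕ, 1 ≤ n →
      (∃ δ : ℕ, GenRed.ForGeneralMinimalReduction I d fun J =>
        GenRed.quotLength (I ^ n) (J ^ n) = δ) ∧
      (∃ δ : ℕ, GenRed.ForGeneralMinimalReduction I d fun J =>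
        GenRed.quotLength (I ^ n) (J * I ^ (n - 1) + I ^ (n + 1)) = δ) ∧
      (GenRed.IsEquicharacteristic R → GenRed.ForGeneralMinimalReduction I d fun J =>
        ∀ H : Ideal R, GenRed.IsMinimalReduction H I →
          GenRed.quotLength (I ^ n) (J ^ n) ≤ GenRed.quotLength (I ^ n) (H ^ n) ∧
          GenRed.quotLength (I ^ n) (J * I ^ (n - 1) + I ^ (n + 1)) ≤
            GenRed.quotLength (I ^ n) (H * I ^ (n - 1) + I ^ (n + 1)))) ∧
    (GenRed.IsEquicharacteristic R → GenRed.IsCohenMacaulayLocal R →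
      I.radical = IsLocalRing.maximalIdeal R →
      GenRed.ForGeneralMinimalReduction I d fun J =>
        ∀ H : Ideal R, GenRed.IsMinimalReduction H I →
          GenRed.quotLength (J ⊓ I ^ 2) (J * I) ≤ GenRed.quotLength (H ⊓ I ^ 2) (H * I) ∧
          (H ⊓ I ^ 2 = H * I → J ⊓ I ^ 2 = J * I)) := by
  refine ⟨fun hl hG n hn => ?_, fun _ hCM hI => ?_⟩
  · have hcard := independentReductionsHaveCard_of_analyticSpread hl
    obtain ⟨J, c, hJ, hc⟩ := hG.exists_isMinimalReduction hd hcard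
    have hfin := quotLength_pow_ne_top hJ.1.1 hc n
    refine ⟨(isSpecializedLength_pow I d n).exists_forGeneral_eq hcard hJ hfin,
      (isSpecializedLength_mul_add I d hn).exists_forGeneral_eq hcard hJ
        (ne_top_of_le_ne_top hfin (quotLength_anti_right (pow_le_mul_add hJ.1.1 hn)
          (mul_add_le_pow hJ.1.1 hn))), fun _ => ?_⟩
    refine forGeneralMinimalReduction_of_generically fun s a ha => ?_
    refine ((hcard.generically_isMinimalReduction ha).and
      (((isSpecializedLength_pow I d n).generically_le hcard ha).and
        ((isSpecializedLength_mul_add I d hn).generically_le hcard ha))).mono ?_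
    rintro α ⟨hα, h1, h2⟩
    exact ⟨hα, fun H hH => ⟨h1 H hH, h2 H hH⟩⟩
  · have hcard := independentReductionsHaveCard_of_radical hI hd
    refine forGeneralMinimalReduction_of_generically fun s a ha => ?_
    refine ((hcard.generically_isMinimalReduction ha).and
      (((isSpecializedLength_mul I d).generically_le hcard ha).and
        ((isSpecializedLength_top_sup I (I ^ 2) d).generically_le hcard ha))).mono ?_
    rintro α ⟨hα, h1, h2⟩
    have key : ∀ H : Ideal R, IsMinimalReduction H I →
        quotLength (combinationIdeal a α ⊓ I ^ 2) (combinationIdeal a α * I) ≤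
          quotLength (H ⊓ I ^ 2) (H * I) := by
      intro H hH
      -- Adding the finite length of R/J makes `quotLength_inf_add` applicable; afterwards it is
      -- compared with the length of R/H.
      refine (ENat.add_le_add_iff_right (hα.1.quotLength_top_ne_top hI)).1 ?_
      rw [quotLength_inf_add hα.1.1]
      refine (add_le_add (h1 H hH) (h2 H hH)).trans ?_
      rw [← quotLength_inf_add hH.1.1]
      exact add_le_add_right (hCM.quotLength_top_le hd hI hα hH) _
    refine ⟨hα, fun H hH => ⟨key H hH, fun h => le_antisymm ?_ ?_⟩⟩
    · rw [← quotLength_eq_zero_iff]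
      have := key H hH
      rwa [quotLength_eq_zero_iff.2 h.le, nonpos_iff_eq_zero] at this
    · exact le_inf Ideal.mul_le_left (by rw [pow_two]; exact Ideal.mul_mono_left hα.1.1)
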